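/- Let $E\subset\mathbb C^N$ be compact and let $w:E\to[0,\infty)$ be an admissible weight, i.e. $w$ is upper semicontinuous and $\{z\in E: w(z)>0\}$ is not pluripolar. Let $\mu$ be a finite positive Borel measure with $\operatorname{supp}\mu=E$ such that $(E,w,\mu)$ satisfies the weighted Bernstein–Markov inequality: for every $\varepsilon>0$ there is a $C>0$ such that $\|w^dp\|_E\le C(1+\varepsilon)^d\|w^dp\|_{L^2(\mu)}$ for all integers $d\ge 0$ and all polynomials $p$ of degree $\le d$, where $\|\cdot\|_E$ is the sup norm on $E$. Order the multi-indices in $\mathbb N^N$ by the graded lexicographic order (first by $|\alpha|=\alpha_1+\dots+\alpha_N$, then lexicographically). For each $d$ there is a unique family of polynomials $p^d_\alpha(z)=a^d_\alpha z^\alpha+\sum_{\beta<\alpha}c_\beta z^\beta$, $\alpha\in\mathbb N^N$, with $a^d_\alpha>0$ and $\int p^d_\alpha\,\overline{p^d_\beta}\,w^{2d}\,d\mu=\delta_{\alpha\beta}$ for all $\alpha,\beta$ (the weighted orthonormal polynomials). Let $\theta\in\mathbb R^N$ with $\theta_i>0$ for all $i$ and $\sum_i\theta_i=1$. Then there is a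 number $\tau^w(E,\theta)\in(0,\infty)$, the weighted directional Chebyshev constant, such that for every sequence of multi-indices $\alpha(j)$ with $|\alpha(j)|\to\infty$ and $\alpha(j)/|\alpha(j)|\to\theta$ one has, with $d=|\alpha(j)|$, $$\lim_{j\to\infty}\Big(\inf\Big\{\|w^dq\|_E:\ q=z^{\alpha(j)}+\sum_{\beta<\alpha(j)}c_\beta z^\beta,\ c_\beta\in\mathbb C\Big\}\Big)^{1/d}=\tau^w(E,\theta),$$ and $$\lim_{j\to\infty}\big(a^{d}_{\alpha(j)}\big)^{1/d}=\frac1{\tau^w(E,\theta)}.$$ -/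

import Mathlib

open MeasureTheory Filter Topology

noncomputable section

namespace WeightedPoly

/-- The mean over the unit circle of `t ↦ v (a + e^{2πit} b)` for an extended-real-valued `v`, as the
integral of the positive part minus the integral of the negative part. (For `v` upper semicontinuous
and `< +∞` on the circle the first of these is finite, so that the difference is meaningful, with
values in `[-∞, ∞)`.) -/
def circleMean {N : ℕ} (v : (Fin N → ℂ) → EReal) (a b : Fin N → ℂ) : EReal :=
  ((∫⁻ t in Set.Ioc (0 : ℝ) 1,
      (v (a + Complex.exp (2 * Real.pi * t * Complex.I) • b)).toENNReal : ENNReal) : EReal) -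
  ((∫⁻ t in Set.Ioc (0 : ℝ) 1,
      (-v (a + Complex.exp (2 * Real.pi * t * Complex.I) • b)).toENNReal : ENNReal) : EReal)

/-- `v : U → [-∞, ∞)` is plurisubharmonic on the open set `U ⊆ ℂ^N`: it is upper semicontinuous, it
satisfies the sub-mean value inequality on every closed affine complex disc contained in `U`, and it
is not identically `-∞` on any connected component of `U`. -/
structure IsPSH {N : ℕ} (U : Set (Fin N → ℂ)) (v : (Fin N → ℂ) → EReal) : Prop where
  lt_top : ∀ z ∈ U, v z < ⊤
  usc : UpperSemicontinuousOn v U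
  sub_mean : ∀ a b : Fin N → ℂ, (∀ ζ : ℂ, ‖ζ‖ ≤ 1 → a + ζ • b ∈ U) → v a ≤ circleMean v a b
  ne_bot : ∀ x ∈ U, ∃ y ∈ connectedComponentIn U x, v y ≠ ⊥

/-- `F ⊆ ℂ^N` is pluripolar: every point of `F` has an open neighbourhood `U` carrying a
plurisubharmonic function that equals `-∞` on `F ∩ U`. -/
def IsPluripolar {N : ℕ} (F : Set (Fin N → ℂ)) : Prop :=
  ∀ a ∈ F, ∃ U : Set (Fin N → ℂ), IsOpen U ∧ a ∈ U ∧
    ∃ v : (Fin N → ℂ) → EReal, IsPSH U v ∧ ∀ z ∈ F ∩ U, v z = ⊥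

/-- `w` is an admissible weight on `E` (only the values of `w` on `E` matter). -/
structure IsAdmissibleWeight {N : ℕ} (E : Set (Fin N → ℂ)) (w : (Fin N → ℂ) → ℝ) : Prop where
  nonneg : ∀ z ∈ E, 0 ≤ w z
  usc : UpperSemicontinuousOn w E
  not_pluripolar : ¬ IsPluripolar {z ∈ E | 0 < w z}

/-- The sup norm `‖w^d p‖_E`. -/
def supNorm {N : ℕ} (E : Set (Fin N → ℂ)) (w : (Fin N → ℂ) → ℝ) (d : ℕ)
    (p : MvPolynomial (Fin N) ℂ) : ℝ :=
  sSup ((fun z => w z ^ d * ‖MvPolynomial.eval z p‖) '' E)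

/-- The norm `‖w^d p‖_{L²(μ)}`. -/
def l2Norm {N : ℕ} (w : (Fin N → ℂ) → ℝ) (μ : Measure (Fin N → ℂ)) (d : ℕ)
    (p : MvPolynomial (Fin N) ℂ) : ℝ :=
  Real.sqrt (∫ z, (w z ^ d * ‖MvPolynomial.eval z p‖) ^ 2 ∂μ)

/-- The weighted Bernstein–Markov inequality for `(E, w, μ)`. -/
def WeightedBernsteinMarkov {N : ℕ} (E : Set (Fin N → ℂ)) (w : (Fin N → ℂ) → ℝ)
    (μ : Measure (Fin N → ℂ)) : Prop :=
  ∀ ε : ℝ, 0 < ε → ∃ C : ℝ, 0 < C ∧ ∀ (d : ℕ) (p : MvPolynomial (Fin N) ℂ),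
    p.totalDegree ≤ d → supNorm E w d p ≤ C * (1 + ε) ^ d * l2Norm w μ d p

/-- `β` precedes `α` in the graded lexicographic order: `|β| < |α|`, or `|β| = |α|` and `β_i < α_i`
for the first `i` with `β_i ≠ α_i`. -/
def Precedes {N : ℕ} (β α : Fin N →₀ ℕ) : Prop := toDegLex β < toDegLex α

/-- `p = p^d_α`, `α ∈ ℕ^N`, is the family of weighted orthonormal polynomials of index `d`, that is,
the result of applying the Gram–Schmidt procedure in `L²(w^{2d} μ)` to the monomials in graded
lexicographic order: the `p^d_α` are orthonormal, and `p^d_α` is the sum of `a z^α`, `a > 0`, and of a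
linear combination of monomials `z^β` that precede `z^α`. -/
structure IsOrthonormalFamily {N : ℕ} (w : (Fin N → ℂ) → ℝ) (μ : Measure (Fin N → ℂ)) (d : ℕ)
    (p : (Fin N →₀ ℕ) → MvPolynomial (Fin N) ℂ) : Prop where
  orthonormal : ∀ α β, ∫ z, MvPolynomial.eval z (p α) *
    (starRingEnd ℂ) (MvPolynomial.eval z (p β)) * ((w z : ℂ) ^ (2 * d)) ∂μ =
      if α = β then 1 else 0
  lower : ∀ α β, β ≠ α → (p α).coeff β ≠ 0 → Precedes β α
  lead_real : ∀ α, ((p α).coeff α).im = 0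
  lead_pos : ∀ α, 0 < ((p α).coeff α).re

/-- The class `P(α)` of polynomials `z^α + ∑_{β < α} c_β z^β`. -/
def monicClass {N : ℕ} (α : Fin N →₀ ℕ) : Set (MvPolynomial (Fin N) ℂ) :=
  {q | q.coeff α = 1 ∧ ∀ β, β ≠ α → q.coeff β ≠ 0 → Precedes β α}

/-- The minimal norm `inf {‖w^d q‖_E : q ∈ P(α)}`, where `d = |α|`. -/
def chebyshevNorm {N : ℕ} (E : Set (Fin N → ℂ)) (w : (Fin N → ℂ) → ℝ) (α : Fin N →₀ ℕ) : ℝ :=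
  sInf (supNorm E w α.degree '' monicClass α)

/-- `|α(j)| → ∞` and `α(j) / |α(j)| → θ`. -/
def HasDirection {N : ℕ} (α : ℕ → (Fin N →₀ ℕ)) (θ : Fin N → ℝ) : Prop :=
  Tendsto (fun j => (α j).degree) atTop atTop ∧
  Tendsto (fun j (i : Fin N) => ((α j i : ℝ) / ((α j).degree : ℝ))) atTop (𝓝 θ)

/-- `τ` is the weighted directional Chebyshev constant `τ^w(E, θ)`: the common limit of
`(inf {‖w^d q‖_E : q ∈ P(α(j))})^{1/d}`, `d = |α(j)|`, over all sequences `α(j)` of direction `θ`. -/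
def IsDirectionalChebyshevConstant {N : ℕ} (E : Set (Fin N → ℂ)) (w : (Fin N → ℂ) → ℝ)
    (θ : Fin N → ℝ) (τ : ℝ) : Prop :=
  ∀ α : ℕ → (Fin N →₀ ℕ), HasDirection α θ →
    Tendsto (fun j => chebyshevNorm E w (α j) ^ (1 / ((α j).degree : ℝ))) atTop (𝓝 τ)

end WeightedPoly

end

/-!
The minimal norms `Y α = chebyshevNorm E w α` are submultiplicative, because the graded
lexicographic order is a monomial order: `P(α) * P(β) ⊆ P(α + β)` (`chebyshevNorm_add_le`). Hence
`log Y` is subadditive on `ℕ^N`. If `α / |α|` and `β / |β|` are both close to a `θ` with positive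
entries and `|β|` is much larger than `|α|`, then `β = m α + r` with `m` a natural number and
`|r|` small compared to `|β|`, so that `log (Y β) / |β|` exceeds `log (Y α) / |α|` by little
(`subadditive_div_degree_le`); therefore `log (Y α) / |α|` converges in the direction `θ`
(`subadditive_exists_tendsto_div_degree`), and `τ` is the exponential of the limit.

This needs `|log (Y α)| ≤ C |α|`. The upper bound comes from the monomials. The lower bound is where
non-pluripolarity enters (`IsAdmissibleWeight.exists_pow_le_supNorm`): if `q_j ∈ P(α_j)` had weighted
norms below `exp (-4 ^ j * |α_j|)`, then, after scaling the `q_j` to be at most `1` on a large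
ball, a subsequence of `(1 / |α_j|) log |q_j|` with weights `2 ^ (-k)` would sum to a plurisubharmonic
function equal to `-∞` on `{w > 0}`. The sum is not identically `-∞`: each scaled polynomial is as
large as `κ ^ |α_j|` somewhere in the unit polydisc, the sub-mean value property turns this into a
bound for the mean of `-(1 / |α_j|) log |q_j|` over the polydisc, and Fatou's lemma gives a point
where infinitely many of these functions stay bounded (`exists_mem_ball_frequently_le`).

The same lower bound and the Bernstein–Markov inequality make `L²(w^{2d} μ)` a genuine inner product
on polynomials, so Gram–Schmidt produces the orthonormal family. Its leading coefficient `a` at `α`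
satisfies `1 / a = min {‖w^d q‖_{L²(μ)} : q ∈ P(α)}`, which lies between `Y α / (C (1 + ε)^d)` and
`√μ(ℂ^N) * Y α` with `d = |α|`. On taking `d`-th roots the constants disappear, and `ε` is
arbitrary.
-/

open scoped ENNReal

noncomputable section

namespace WeightedPoly

/-! ### Sub-mean value inequalities for logarithms of polynomials -/

/-- `-log x` for `x ≤ 1`, with values in `[0, ∞]` and the value `∞` at `0`; it is `0` for `x ≥ 1`.
Working with this nonnegative function in place of `log` allows sums and integrals of logarithms of
polynomials that are bounded by `1` to be formed without integrability conditions. -/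
def logDefect (x : ℝ≥0∞) : ℝ≥0∞ := (-ENNReal.log x).toENNReal

lemma continuous_logDefect : Continuous logDefect :=
  EReal.continuous_toENNReal.comp (ENNReal.continuous_log.neg)

lemma logDefect_zero : logDefect 0 = ⊤ := by simp [logDefect]

lemma logDefect_ofReal {x : ℝ} (hx : 0 < x) :
    logDefect (ENNReal.ofReal x) = ENNReal.ofReal (-Real.log x) := by
  rw [logDefect, ENNReal.log_ofReal_of_pos hx, ← EReal.coe_neg, EReal.toENNReal_of_ne_top (by simp)]
  simp

lemma logDefect_anti : Antitone logDefect := fun _ _ h =>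
  EReal.toENNReal_le_toENNReal (EReal.neg_le_neg_iff.2 (ENNReal.log_monotone h))

lemma norm_exp_two_pi_mul_I (t : ℝ) : ‖Complex.exp (2 * Real.pi * t * Complex.I)‖ = 1 := by
  have : (2 * Real.pi * t * Complex.I : ℂ) = ((2 * Real.pi * t : ℝ) : ℂ) * Complex.I := by
    push_cast; ring
  rw [this, Complex.norm_exp_ofReal_mul_I]

/-- The sub-mean value inequality for `log |P|`, from the fact that the Mahler measure of `P` is at
least the modulus of the constant coefficient. -/
lemma lintegral_logDefect_circle_le (P : Polynomial ℂ) (hP : ∀ ζ : ℂ, ‖ζ‖ = 1 → ‖P.eval ζ‖ ≤ 1) :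
    ∫⁻ t in Set.Ioc (0 : ℝ) 1,
      logDefect ‖P.eval (Complex.exp (2 * Real.pi * t * Complex.I))‖ₑ ≤
        logDefect ‖P.eval 0‖ₑ := by
  by_cases h0 : P.eval 0 = 0
  · simp [h0, logDefect_zero]
  have hP0 : P ≠ 0 := by rintro rfl; simp at h0
  set e : ℝ → ℂ := fun t => Complex.exp (2 * Real.pi * t * Complex.I) with he
  have hcm : ∀ t : ℝ, circleMap 0 1 (2 * Real.pi * t) = e t := by
    intro t; simp [circleMap, he]
  have hint : IntegrableOn (fun t => Real.log ‖P.eval (e t)‖) (Set.Ioc 0 1) := by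
    have h := P.intervalIntegrable_mahlerMeasure.comp_mul_left (c := 2 * Real.pi)
    simp only [hcm, zero_div, div_self (by positivity : (2 * Real.pi) ≠ 0)] at h
    rwa [intervalIntegrable_iff_integrableOn_Ioc_of_le zero_le_one] at h
  have havg : ∫ t in Set.Ioc (0 : ℝ) 1, Real.log ‖P.eval (e t)‖ = P.logMahlerMeasure := by
    rw [← intervalIntegral.integral_of_le zero_le_one, Polynomial.logMahlerMeasure_def,
      Real.circleAverage_def]
    have := intervalIntegral.integral_comp_mul_left (a := 0) (b := 1)
      (fun θ => Real.log ‖P.eval (circleMap 0 1 θ)‖) (c := 2 * Real.pi) (by positivity)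
    simp only [hcm, mul_zero, mul_one] at this
    exact this
  -- At a zero of `P` the real logarithm has the value `0` and `logDefect` the value `∞`, so the zeros
  -- on the circle have to be discarded; there are finitely many.
  have hne : ∀ᵐ t ∂(volume.restrict (Set.Ioc (0 : ℝ) 1)), P.eval (e t) ≠ 0 := by
    rw [ae_restrict_iff' measurableSet_Ioc]
    have hinj : Set.InjOn e (Set.Ioc 0 1) := by
      intro s hs t ht hst
      simp only [he] at hst
      obtain ⟨n, hn⟩ := Complex.exp_eq_exp_iff_exists_int.1 hst
      have h1 : (s : ℂ) = t + n := by
        have : (2 * Real.pi * Complex.I : ℂ) ≠ 0 := by simp [Real.pi_ne_zero]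
        apply mul_left_cancel₀ this
        linear_combination hn
      have h2 : s = t + n := by exact_mod_cast h1
      have h3 : n = 0 := by
        have a1 : (n : ℝ) < 1 := by linarith [hs.2, ht.1]
        have a2 : (-1 : ℝ) < n := by linarith [hs.1, ht.2]
        have : n < 1 := by exact_mod_cast a1
        have : -1 < n := by exact_mod_cast a2
        omega
      simpa [h3] using h2
    have hfin : (Set.Ioc (0 : ℝ) 1 ∩ e ⁻¹' {z | P.eval z = 0}).Finite := by
      apply Set.Finite.of_finite_image (f := e) _ (hinj.mono Set.inter_subset_left)
      apply (P.roots.toFinset.finite_toSet).subset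
      rintro _ ⟨t, ht, rfl⟩
      simpa [hP0] using ht.2
    filter_upwards [(hfin.measure_zero volume : _) |> compl_mem_ae_iff.2] with t ht h1 h2
    exact ht ⟨h1, h2⟩
  calc ∫⁻ t in Set.Ioc (0 : ℝ) 1, logDefect ‖P.eval (e t)‖ₑ
      = ∫⁻ t in Set.Ioc (0 : ℝ) 1, ENNReal.ofReal (-Real.log ‖P.eval (e t)‖) := by
        apply lintegral_congr_ae
        filter_upwards [hne] with t ht
        rw [← ofReal_norm, logDefect_ofReal (norm_pos_iff.2 ht)]
    _ = ENNReal.ofReal (∫ t in Set.Ioc (0 : ℝ) 1, -Real.log ‖P.eval (e t)‖) := by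
        refine (ofReal_integral_eq_lintegral_ofReal hint.neg ?_).symm
        exact ae_of_all _ fun t => by
          simpa using Real.log_nonpos (norm_nonneg _) (hP _ (norm_exp_two_pi_mul_I t))
    _ ≤ logDefect ‖P.eval 0‖ₑ := by
        rw [← ofReal_norm, logDefect_ofReal (norm_pos_iff.2 h0), integral_neg, havg,
          P.logMahlerMeasure_eq_log_MahlerMeasure]
        apply ENNReal.ofReal_le_ofReal
        apply neg_le_neg
        apply Real.log_le_log (norm_pos_iff.2 h0)
        simpa [Polynomial.coeff_zero_eq_eval_zero] using P.norm_coeff_le_choose_mul_mahlerMeasure 0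


variable {N : ℕ}

lemma exists_polynomial_eval_line (s : MvPolynomial (Fin N) ℂ) (a b : Fin N → ℂ) :
    ∃ P : Polynomial ℂ, ∀ ζ : ℂ, P.eval ζ = MvPolynomial.eval (a + ζ • b) s := by
  refine ⟨MvPolynomial.aeval (fun i => Polynomial.C (a i) + Polynomial.C (b i) * Polynomial.X) s,
    fun ζ => ?_⟩
  induction s using MvPolynomial.induction_on with
  | C c => simp
  | add p q hp hq => simp only [map_add, Polynomial.eval_add, hp, hq]
  | mul_X p i hp =>
    simp only [map_mul, Polynomial.eval_mul, hp, MvPolynomial.aeval_X, MvPolynomial.eval_X,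
      Polynomial.eval_add, Polynomial.eval_C,
      Polynomial.eval_X, Pi.add_apply, Pi.smul_apply, smul_eq_mul, mul_comm ζ]

lemma lintegral_logDefect_disc_le (s : MvPolynomial (Fin N) ℂ) (a b : Fin N → ℂ)
    (hs : ∀ ζ : ℂ, ‖ζ‖ = 1 → ‖MvPolynomial.eval (a + ζ • b) s‖ ≤ 1) :
    ∫⁻ t in Set.Ioc (0 : ℝ) 1,
      logDefect ‖MvPolynomial.eval (a + Complex.exp (2 * Real.pi * t * Complex.I) • b) s‖ₑ ≤
        logDefect ‖MvPolynomial.eval a s‖ₑ := by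
  obtain ⟨P, hP⟩ := exists_polynomial_eval_line s a b
  have := lintegral_logDefect_circle_le P (fun ζ hζ => by rw [hP]; exact hs ζ hζ)
  simpa [hP] using this

lemma continuous_logDefect_eval (s : MvPolynomial (Fin N) ℂ) :
    Continuous fun z => logDefect ‖MvPolynomial.eval z s‖ₑ :=
  continuous_logDefect.comp (MvPolynomial.continuous_eval s).enorm

lemma measurePreserving_smul_of_norm_eq_one {u : ℂ} (hu : ‖u‖ = 1) :
    MeasurePreserving (fun b : Fin N → ℂ => u • b) := by
  have h1 : MeasurePreserving (fun z : ℂ => u * z) := by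
    have := (rotation (⟨u, by simpa [Submonoid.unitSphere] using hu⟩ : Circle)).measurePreserving
    exact this
  exact volume_preserving_pi (fun _ : Fin N => h1)

/-- The sub-mean value inequality, averaged over all discs centred at `x` with radius vector in the
polydisc of radius `2`: a polynomial that is not small at one point of the unit polydisc is not
small in the mean over it. -/
lemma lintegral_logDefect_ball_le (s : MvPolynomial (Fin N) ℂ)
    (hs : ∀ z ∈ Metric.ball (0 : Fin N → ℂ) 3, ‖MvPolynomial.eval z s‖ ≤ 1)
    {x : Fin N → ℂ} (hx : ‖x‖ ≤ 1) :
    ∫⁻ z in Metric.ball (0 : Fin N → ℂ) 1, logDefect ‖MvPolynomial.eval z s‖ₑ ≤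
      volume (Metric.ball (0 : Fin N → ℂ) 2) * logDefect ‖MvPolynomial.eval x s‖ₑ := by
  set g : (Fin N → ℂ) → ℝ≥0∞ := fun z => logDefect ‖MvPolynomial.eval z s‖ₑ with hg
  have hgc : Continuous g := continuous_logDefect_eval s
  set V := Metric.ball (0 : Fin N → ℂ) 2 with hV
  set e : ℝ → ℂ := fun t => Complex.exp (2 * Real.pi * t * Complex.I) with he
  have hec : Continuous e := by fun_prop
  have step1 : ∫⁻ z in Metric.ball (0 : Fin N → ℂ) 1, g z ≤ ∫⁻ b in V, g (x + b) := by
    have h1 : Metric.ball (0 : Fin N → ℂ) 1 ⊆ Metric.ball x 2 := by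
      intro z hz
      rw [mem_ball_zero_iff] at hz
      rw [mem_ball_iff_norm]
      linarith [norm_sub_le z x]
    have h2 : ∫⁻ b in V, g (x + b) = ∫⁻ z in Metric.ball x 2, g z := by
      have := (measurePreserving_add_left (volume : Measure (Fin N → ℂ)) x).setLIntegral_comp_preimage
        (s := Metric.ball x 2) Metric.isOpen_ball.measurableSet hgc.measurable
      rw [← this]
      congr 2
      ext b
      simp [hV]
    rw [h2]
    exact lintegral_mono_set h1
  -- The polydisc `V` and its volume are invariant under `b ↦ e^{2πit} b`, so an average over `t` may be
  -- inserted and, by Tonelli, taken first.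
  have step2 : ∀ t : ℝ, ∫⁻ b in V, g (x + e t • b) = ∫⁻ b in V, g (x + b) := by
    intro t
    have := (measurePreserving_smul_of_norm_eq_one (N := N)
      (norm_exp_two_pi_mul_I t)).setLIntegral_comp_preimage
      (s := V) Metric.isOpen_ball.measurableSet (f := fun b => g (x + b))
      (by fun_prop)
    rw [← this]
    congr 2
    ext b
    simp [hV, norm_smul, norm_exp_two_pi_mul_I]
  calc ∫⁻ z in Metric.ball (0 : Fin N → ℂ) 1, g z ≤ ∫⁻ b in V, g (x + b) := step1
    _ = ∫⁻ t in Set.Ioc (0 : ℝ) 1, ∫⁻ b in V, g (x + e t • b) := by simp [step2]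
    _ = ∫⁻ b in V, ∫⁻ t in Set.Ioc (0 : ℝ) 1, g (x + e t • b) := by
        apply lintegral_lintegral_swap
        apply Measurable.aemeasurable
        apply Continuous.measurable
        fun_prop
    _ ≤ ∫⁻ _ in V, g x := by
        apply setLIntegral_mono' Metric.isOpen_ball.measurableSet
        intro b hb
        apply lintegral_logDefect_disc_le
        intro ζ hζ
        apply hs
        rw [mem_ball_zero_iff] at hb ⊢
        have := norm_add_le x (ζ • b)
        rw [norm_smul, hζ] at this
        linarith
    _ = volume V * g x := by rw [setLIntegral_const, mul_comm]

/-! ### Plurisubharmonic sums -/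

/-- A sum of the functions `c_k log |s_k|`, where `|s_k| ≤ 1` on the ball, is plurisubharmonic there
as soon as it is finite at one point. -/
lemma isPSH_neg_tsum_logDefect {R : ℝ} (s : ℕ → MvPolynomial (Fin N) ℂ) (c : ℕ → ℝ≥0∞)
    (hc : ∀ k, c k ≠ ⊤)
    (hs : ∀ k, ∀ z ∈ Metric.ball (0 : Fin N → ℂ) R, ‖MvPolynomial.eval z (s k)‖ ≤ 1)
    {y : Fin N → ℂ} (hy : y ∈ Metric.ball (0 : Fin N → ℂ) R)
    (hfin : ∑' k, c k * logDefect ‖MvPolynomial.eval y (s k)‖ₑ ≠ ⊤) :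
    IsPSH (Metric.ball (0 : Fin N → ℂ) R)
      (fun z => -((∑' k, c k * logDefect ‖MvPolynomial.eval z (s k)‖ₑ : ℝ≥0∞) : EReal)) := by
  have hcont : ∀ k, Continuous fun z => c k * logDefect ‖MvPolynomial.eval z (s k)‖ₑ := fun k =>
    (ENNReal.continuous_const_mul (hc k)).comp (continuous_logDefect_eval (s k))
  set G : (Fin N → ℂ) → ℝ≥0∞ := fun z => ∑' k, c k * logDefect ‖MvPolynomial.eval z (s k)‖ₑ with hG
  have hlsc : LowerSemicontinuous G :=
    lowerSemicontinuous_tsum fun k => (hcont k).lowerSemicontinuous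
  refine ⟨?_, ?_, ?_, ?_⟩
  · intro z _
    refine lt_of_le_of_lt (b := 0) ?_ (by simp)
    exact EReal.neg_le_zero.2 (EReal.coe_ennreal_nonneg _)
  · have : UpperSemicontinuous fun z => -((G z : ℝ≥0∞) : EReal) := by
      have h1 : LowerSemicontinuous fun z => ((G z : ℝ≥0∞) : EReal) :=
        continuous_coe_ennreal_ereal.comp_lowerSemicontinuous hlsc
          (fun _ _ h => EReal.coe_ennreal_le_coe_ennreal_iff.2 h)
      exact continuous_neg.comp_lowerSemicontinuous_antitone h1
        (fun _ _ h => EReal.neg_le_neg_iff.2 h)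
    exact this.upperSemicontinuousOn _
  · intro a b hab
    have h1 : ∀ z, (-((G z : ℝ≥0∞) : EReal)).toENNReal = 0 := fun z =>
      EReal.toENNReal_of_nonpos (EReal.neg_le_zero.2 (EReal.coe_ennreal_nonneg _))
    change -((G a : ℝ≥0∞) : EReal) ≤ circleMean (fun z => -((G z : ℝ≥0∞) : EReal)) a b
    simp only [circleMean, h1, neg_neg, EReal.toENNReal_coe]
    simp only [lintegral_zero, EReal.coe_ennreal_zero, zero_sub, EReal.neg_le_neg_iff,
      EReal.coe_ennreal_le_coe_ennreal_iff]
    simp only [hG]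
    have hec : Continuous fun t : ℝ => a + Complex.exp (2 * Real.pi * t * Complex.I) • b := by
      fun_prop
    have hm : ∀ k, Continuous fun t : ℝ => c k * logDefect ‖MvPolynomial.eval
        (a + Complex.exp (2 * Real.pi * t * Complex.I) • b) (s k)‖ₑ := fun k => (hcont k).comp hec
    rw [lintegral_tsum fun k => (hm k).measurable.aemeasurable]
    apply ENNReal.tsum_le_tsum
    intro k
    rw [lintegral_const_mul' _ _ (hc k)]
    gcongr
    exact lintegral_logDefect_disc_le (s k) a b fun ζ hζ => hs k _ (hab ζ hζ.le)
  · intro x hx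
    rw [(convex_ball (0 : Fin N → ℂ) R).isPreconnected.connectedComponentIn hx]
    exact ⟨y, hy, by simpa using hfin⟩

/-! ### Coefficient estimates and normalization -/

lemma sum_pow_mul_inv_pow_eq {M : ℕ} (hM : M ≠ 0) {ω : ℂ} (hω : IsPrimitiveRoot ω M) {a b : ℕ}
    (ha : a < M) (hb : b < M) :
    ∑ j : Fin M, (ω ^ (j : ℕ)) ^ a * ((ω ^ (j : ℕ)) ^ b)⁻¹ = if a = b then (M : ℂ) else 0 := by
  have h0 : ω ≠ 0 := hω.ne_zero hM
  have h1 : ∀ j : Fin M, (ω ^ (j : ℕ)) ^ a * ((ω ^ (j : ℕ)) ^ b)⁻¹ =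
      (ω ^ a * (ω ^ b)⁻¹) ^ (j : ℕ) := by
    intro j; rw [mul_pow, inv_pow, ← pow_mul, ← pow_mul, ← pow_mul, ← pow_mul, mul_comm a,
      mul_comm b]
  simp only [h1]
  split_ifs with hab
  · subst hab
    simp [mul_inv_cancel₀ (pow_ne_zero a h0)]
  · rw [Fin.sum_univ_eq_sum_range (fun j => (ω ^ a * (ω ^ b)⁻¹) ^ j) M]
    have hne : ω ^ a * (ω ^ b)⁻¹ ≠ 1 := by
      intro h
      rw [mul_inv_eq_one₀ (pow_ne_zero b h0)] at h
      exact hab (hω.pow_inj ha hb h)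
    have := geom_sum_mul (ω ^ a * (ω ^ b)⁻¹) M
    rw [mul_pow, inv_pow, ← pow_mul, ← pow_mul, mul_comm a, mul_comm b, pow_mul, pow_mul,
      hω.pow_eq_one] at this
    simpa [sub_eq_zero, hne] using this

/-- Cauchy's estimate on the unit polydisc, by averaging over tuples of roots of unity of an order
exceeding all exponents. -/
lemma exists_norm_coeff_le_norm_eval (q : MvPolynomial (Fin N) ℂ) (α : Fin N →₀ ℕ) :
    ∃ x : Fin N → ℂ, ‖x‖ ≤ 1 ∧ ‖q.coeff α‖ ≤ ‖MvPolynomial.eval x q‖ := by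
  classical
  by_cases hα : α ∈ q.support
  swap
  · exact ⟨0, by simp, by simp [MvPolynomial.notMem_support_iff.1 hα]⟩
  set M := q.totalDegree + 1 with hM
  have hM0 : M ≠ 0 := by omega
  set ω : ℂ := Complex.exp (2 * Real.pi * Complex.I / M) with hω'
  have hω : IsPrimitiveRoot ω M := Complex.isPrimitiveRoot_exp M hM0
  have hnω : ‖ω‖ = 1 := hω.norm'_eq_one hM0
  have hlt : ∀ β ∈ q.support, ∀ i, β i < M := fun β hβ i => by
    have h1 := MvPolynomial.le_totalDegree hβ
    have h2 := Finsupp.le_degree i β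
    rw [Finsupp.degree_apply] at h2
    exact Nat.lt_succ_of_le (h2.trans h1)
  set x : (Fin N → Fin M) → Fin N → ℂ := fun k i => ω ^ (k i : ℕ) with hx
  have key : ∑ k : Fin N → Fin M, MvPolynomial.eval (x k) q * ∏ i, (x k i ^ α i)⁻¹ =
      (M : ℂ) ^ N * q.coeff α := by
    simp only [MvPolynomial.eval_eq', Finset.sum_mul]
    rw [Finset.sum_comm]
    have h1 : ∀ β ∈ q.support, ∑ k : Fin N → Fin M,
        (q.coeff β * ∏ i, x k i ^ β i) * ∏ i, (x k i ^ α i)⁻¹ =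
          if β = α then (M : ℂ) ^ N * q.coeff α else 0 := by
      intro β hβ
      have h2 : ∑ k : Fin N → Fin M, ∏ i, (x k i ^ β i * (x k i ^ α i)⁻¹) =
          ∏ i, ∑ j : Fin M, ((ω ^ (j : ℕ)) ^ β i * ((ω ^ (j : ℕ)) ^ α i)⁻¹) := by
        rw [Finset.prod_univ_sum, Fintype.piFinset_univ]
      simp only [mul_assoc, ← Finset.mul_sum, ← Finset.prod_mul_distrib]
      rw [h2, Finset.prod_congr rfl fun i _ =>
        sum_pow_mul_inv_pow_eq hM0 hω (hlt β hβ i) (hlt α hα i)]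
      split_ifs with h
      · subst h; simp [mul_comm]
      · obtain ⟨i, hi⟩ := Finsupp.ne_iff.1 h
        rw [Finset.prod_eq_zero (Finset.mem_univ i) (by simp [hi]), mul_zero]
    rw [Finset.sum_congr rfl h1, Finset.sum_ite_eq' q.support α]
    simp [hα]
  have hxn : ∀ k i, ‖x k i‖ = 1 := fun k i => by simp [hx, hnω]
  have hle : ∑ _k : Fin N → Fin M, ‖q.coeff α‖ ≤
      ∑ k : Fin N → Fin M, ‖MvPolynomial.eval (x k) q‖ := by
    calc ∑ _k : Fin N → Fin M, ‖q.coeff α‖ = ‖(M : ℂ) ^ N * q.coeff α‖ := by simp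
      _ ≤ ∑ k : Fin N → Fin M, ‖MvPolynomial.eval (x k) q * ∏ i, (x k i ^ α i)⁻¹‖ := by
        rw [← key]; exact norm_sum_le _ _
      _ = _ := by simp [hxn]
  have : NeZero M := ⟨hM0⟩
  obtain ⟨k, -, hk⟩ := Finset.exists_le_of_sum_le (Finset.univ_nonempty) hle
  exact ⟨x k, (pi_norm_le_iff_of_nonneg zero_le_one).2 fun i => (hxn k i).le, hk⟩

lemma Precedes.degree_le {α β : Fin N →₀ ℕ} (h : Precedes β α) : β.degree ≤ α.degree :=
  Finsupp.DegLex.monotone_degree h.le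

lemma degree_le_of_mem_monicClass {α β : Fin N →₀ ℕ} {q : MvPolynomial (Fin N) ℂ}
    (hq : q ∈ monicClass α) (hβ : β ∈ q.support) : β.degree ≤ α.degree := by
  by_cases h : β = α
  · rw [h]
  · exact (hq.2 β h (MvPolynomial.mem_support_iff.1 hβ)).degree_le

lemma card_support_le_of_degree_le {q : MvPolynomial (Fin N) ℂ} {d : ℕ}
    (hq : ∀ β ∈ q.support, β.degree ≤ d) : q.support.card ≤ (d + 1) ^ N := by
  have hsub : q.support.card ≤ (Fintype.piFinset fun _ : Fin N => Finset.range (d + 1)).card := by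
    apply Finset.card_le_card_of_injOn (fun β : Fin N →₀ ℕ => (β : Fin N → ℕ))
    · intro β hβ
      simp only [Finset.mem_coe, Fintype.mem_piFinset, Finset.mem_range]
      intro i
      exact Nat.lt_succ_of_le ((Finsupp.le_degree i β).trans (hq β hβ))
    · exact fun _ _ _ _ h => DFunLike.coe_injective h
  simpa [Fintype.card_piFinset] using hsub

lemma norm_eval_le_of_norm_coeff_le {q : MvPolynomial (Fin N) ℂ} {d : ℕ}
    (hq : ∀ β ∈ q.support, β.degree ≤ d) {m R : ℝ} (hm : ∀ β, ‖q.coeff β‖ ≤ m) (hR : 1 ≤ R)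
    {z : Fin N → ℂ} (hz : ‖z‖ ≤ R) : ‖MvPolynomial.eval z q‖ ≤ m * (2 ^ N * R) ^ d := by
  have hm0 : 0 ≤ m := (norm_nonneg _).trans (hm 0)
  rw [MvPolynomial.eval_eq']
  calc ‖∑ β ∈ q.support, q.coeff β * ∏ i, z i ^ β i‖
      ≤ ∑ β ∈ q.support, m * R ^ d := by
        apply norm_sum_le_of_le
        intro β hβ
        rw [norm_mul]
        gcongr
        · exact hm β
        · rw [norm_prod]
          calc ∏ i, ‖z i ^ β i‖ ≤ ∏ i, R ^ β i := by
                apply Finset.prod_le_prod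
                · intros; positivity
                · intro i _
                  rw [norm_pow]
                  gcongr
                  exact (norm_le_pi_norm z i).trans hz
            _ = R ^ β.degree := by rw [Finset.prod_pow_eq_pow_sum, Finsupp.degree_eq_sum]
            _ ≤ R ^ d := pow_le_pow_right₀ hR (hq β hβ)
    _ = q.support.card * (m * R ^ d) := by simp
    _ ≤ (2 ^ N) ^ d * (m * R ^ d) := by
        gcongr
        have h1 := card_support_le_of_degree_le hq
        have h2 : (d + 1) ^ N ≤ (2 ^ d) ^ N := Nat.pow_le_pow_left (Nat.lt_two_pow_self) N
        rw [← pow_mul, mul_comm, pow_mul] at h2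
        exact_mod_cast h1.trans h2
    _ = _ := by rw [mul_pow]; ring

/-- A polynomial in `P(α)` divided by the modulus of its largest coefficient, which is at least
`1`, and by the power `(2 ^ N * R) ^ |α|`, which bounds the growth up to radius `R`. -/
lemma exists_normalization {α : Fin N →₀ ℕ} {q : MvPolynomial (Fin N) ℂ} (hq : q ∈ monicClass α)
    {R : ℝ} (hR : 1 ≤ R) :
    ∃ s : MvPolynomial (Fin N) ℂ,
      (∀ z ∈ Metric.ball (0 : Fin N → ℂ) R, ‖MvPolynomial.eval z s‖ ≤ 1) ∧
      (∃ x : Fin N → ℂ, ‖x‖ ≤ 1 ∧ (2 ^ N * R)⁻¹ ^ α.degree ≤ ‖MvPolynomial.eval x s‖) ∧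
      ∀ z, ‖MvPolynomial.eval z s‖ ≤ ‖MvPolynomial.eval z q‖ := by
  have hα : α ∈ q.support := by simp [hq.1]
  obtain ⟨γ, hγ, hmax⟩ := q.support.exists_max_image (fun β => ‖q.coeff β‖) ⟨α, hα⟩
  set m := ‖q.coeff γ‖ with hm
  have hm1 : 1 ≤ m := by simpa [hq.1] using hmax α hα
  have hle : ∀ β, ‖q.coeff β‖ ≤ m := by
    intro β
    by_cases hβ : β ∈ q.support
    · exact hmax β hβ
    · rw [MvPolynomial.notMem_support_iff.1 hβ, norm_zero]; positivity
  set A : ℝ := 2 ^ N * R with hA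
  have hA1 : 1 ≤ A := one_le_mul_of_one_le_of_one_le (one_le_pow₀ one_le_two) hR
  have hAd : 1 ≤ A ^ α.degree := one_le_pow₀ hA1
  have hev : ∀ z, ‖MvPolynomial.eval z (MvPolynomial.C (((m * A ^ α.degree)⁻¹ : ℝ) : ℂ) * q)‖ =
      (m * A ^ α.degree)⁻¹ * ‖MvPolynomial.eval z q‖ := by
    intro z
    rw [map_mul, MvPolynomial.eval_C, norm_mul, Complex.norm_real, Real.norm_of_nonneg]
    positivity
  refine ⟨MvPolynomial.C (((m * A ^ α.degree)⁻¹ : ℝ) : ℂ) * q, ?_, ?_, ?_⟩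
  · intro z hz
    rw [hev, inv_mul_le_one₀ (by positivity)]
    exact norm_eval_le_of_norm_coeff_le (fun β => degree_le_of_mem_monicClass hq) hle hR
      (mem_ball_zero_iff.1 hz).le
  · obtain ⟨x, hx, hxq⟩ := exists_norm_coeff_le_norm_eval q γ
    refine ⟨x, hx, ?_⟩
    rw [hev, mul_inv m, inv_pow]
    have : (m⁻¹ * (A ^ α.degree)⁻¹) * m ≤ m⁻¹ * (A ^ α.degree)⁻¹ * ‖MvPolynomial.eval x q‖ := by
      gcongr
    refine le_trans (le_of_eq ?_) this
    field_simp
  · intro z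
    rw [hev]
    apply mul_le_of_le_one_left (norm_nonneg _)
    exact inv_le_one_of_one_le₀ (one_le_mul_of_one_le_of_one_le hm1 hAd)

/-! ### The geometric lower bound for weighted norms -/

lemma IsAdmissibleWeight.exists_bound {E : Set (Fin N → ℂ)} (hE : IsCompact E)
    {w : (Fin N → ℂ) → ℝ} (hw : IsAdmissibleWeight E w) : ∃ W : ℝ, 1 ≤ W ∧ ∀ z ∈ E, w z ≤ W := by
  obtain ⟨W, hW⟩ := hw.usc.bddAbove_of_isCompact hE
  exact ⟨max W 1, le_max_right _ _, fun z hz => (hW ⟨z, hz, rfl⟩).trans (le_max_left _ _)⟩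

lemma IsAdmissibleWeight.nonempty {E : Set (Fin N → ℂ)} {w : (Fin N → ℂ) → ℝ}
    (hw : IsAdmissibleWeight E w) : E.Nonempty := by
  by_contra h
  refine hw.not_pluripolar fun a ha => ?_
  exact absurd ⟨a, ha.1⟩ h

lemma IsAdmissibleWeight.bddAbove {E : Set (Fin N → ℂ)} (hE : IsCompact E)
    {w : (Fin N → ℂ) → ℝ} (hw : IsAdmissibleWeight E w) (d : ℕ) (p : MvPolynomial (Fin N) ℂ) :
    BddAbove ((fun z => w z ^ d * ‖MvPolynomial.eval z p‖) '' E) := by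
  obtain ⟨W, hW1, hW⟩ := hw.exists_bound hE
  obtain ⟨K, hK⟩ := hE.bddAbove_image (MvPolynomial.continuous_eval p).norm.continuousOn
  refine ⟨W ^ d * K, ?_⟩
  rintro _ ⟨z, hz, rfl⟩
  have h1 := hw.nonneg z hz
  have h2 := hK ⟨z, hz, rfl⟩
  have h3 := hW z hz
  exact mul_le_mul (pow_le_pow_left₀ h1 h3 d) h2 (norm_nonneg _) (by positivity)

lemma IsAdmissibleWeight.le_supNorm {E : Set (Fin N → ℂ)} (hE : IsCompact E)
    {w : (Fin N → ℂ) → ℝ} (hw : IsAdmissibleWeight E w) (d : ℕ) (p : MvPolynomial (Fin N) ℂ)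
    {z : Fin N → ℂ} (hz : z ∈ E) : w z ^ d * ‖MvPolynomial.eval z p‖ ≤ supNorm E w d p :=
  le_csSup (hw.bddAbove hE d p) ⟨z, hz, rfl⟩

lemma eq_one_of_mem_monicClass {α : Fin N →₀ ℕ} {q : MvPolynomial (Fin N) ℂ}
    (hq : q ∈ monicClass α) (hα : α.degree = 0) : q = 1 := by
  obtain rfl : α = 0 := (Finsupp.degree_eq_zero_iff α).1 hα
  ext β
  rw [MvPolynomial.coeff_one]
  split_ifs with h
  · rw [← h]; exact hq.1
  · by_contra hne
    have h1 := hq.2 β (Ne.symm h) hne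
    have h2 : β.degree = 0 := by simpa using h1.degree_le
    exact h ((Finsupp.degree_eq_zero_iff β).1 h2).symm

lemma logDefect_ofReal_pow {x : ℝ} (hx : 0 < x) (d : ℕ) :
    logDefect (ENNReal.ofReal (x ^ d)) = d * ENNReal.ofReal (-Real.log x) := by
  rw [logDefect_ofReal (pow_pos hx d), Real.log_pow, ← mul_neg, ENNReal.ofReal_mul (by positivity),
    ENNReal.ofReal_natCast]

/-- The functions `-(1 / d_j) log |s_j|` have bounded means over the unit polydisc, so by Fatou's
lemma infinitely many of them are bounded by a common constant at some point. -/
lemma exists_mem_ball_frequently_le (s : ℕ → MvPolynomial (Fin N) ℂ) (d : ℕ → ℕ)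
    (hd : ∀ j, d j ≠ 0) {κ : ℝ} (hκ : 0 < κ)
    (hs : ∀ j, ∀ z ∈ Metric.ball (0 : Fin N → ℂ) 3, ‖MvPolynomial.eval z (s j)‖ ≤ 1)
    (hx : ∀ j, ∃ x : Fin N → ℂ, ‖x‖ ≤ 1 ∧ κ ^ d j ≤ ‖MvPolynomial.eval x (s j)‖) :
    ∃ y ∈ Metric.ball (0 : Fin N → ℂ) 1, ∃ B : ℝ≥0∞, B ≠ ⊤ ∧
      ∃ᶠ j in atTop, (d j : ℝ≥0∞)⁻¹ * logDefect ‖MvPolynomial.eval y (s j)‖ₑ < B := by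
  set g : ℕ → (Fin N → ℂ) → ℝ≥0∞ := fun j z =>
    (d j : ℝ≥0∞)⁻¹ * logDefect ‖MvPolynomial.eval z (s j)‖ₑ with hg
  have hd0 : ∀ j, (d j : ℝ≥0∞) ≠ 0 := fun j => by exact_mod_cast hd j
  have hdt : ∀ j, (d j : ℝ≥0∞) ≠ ⊤ := fun j => ENNReal.natCast_ne_top _
  have hgm : ∀ j, Measurable (g j) := fun j =>
    (continuous_logDefect_eval (s j)).measurable.const_mul _
  set C := volume (Metric.ball (0 : Fin N → ℂ) 2) * ENNReal.ofReal (-Real.log κ) with hC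
  have hCt : C ≠ ⊤ := ENNReal.mul_ne_top measure_ball_lt_top.ne ENNReal.ofReal_ne_top
  have hbd : ∀ j, ∫⁻ z in Metric.ball (0 : Fin N → ℂ) 1, g j z ≤ C := by
    intro j
    obtain ⟨x, hx1, hx2⟩ := hx j
    have h1 := lintegral_logDefect_ball_le (s j) (hs j) hx1
    have h2 : logDefect ‖MvPolynomial.eval x (s j)‖ₑ ≤ d j * ENNReal.ofReal (-Real.log κ) := by
      rw [← logDefect_ofReal_pow hκ, ← ofReal_norm]
      exact logDefect_anti (ENNReal.ofReal_le_ofReal hx2)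
    simp only [hg]
    rw [lintegral_const_mul' _ _ (ENNReal.inv_ne_top.2 (hd0 j))]
    calc (d j : ℝ≥0∞)⁻¹ * _ ≤ (d j : ℝ≥0∞)⁻¹ * (volume (Metric.ball (0 : Fin N → ℂ) 2) *
          (d j * ENNReal.ofReal (-Real.log κ))) := by gcongr; exact h1.trans (by gcongr)
      _ = ((d j : ℝ≥0∞)⁻¹ * d j) * C := by rw [hC]; ring
      _ = C := by rw [ENNReal.inv_mul_cancel (hd0 j) (hdt j), one_mul]
  have hfat : ∫⁻ z in Metric.ball (0 : Fin N → ℂ) 1, liminf (fun j => g j z) atTop ≠ ⊤ := by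
    refine ne_top_of_le_ne_top hCt ((lintegral_liminf_le hgm).trans ?_)
    exact (liminf_le_liminf (Eventually.of_forall hbd)).trans (by simp)
  have hae := ae_lt_top (Measurable.liminf hgm) hfat
  have : NeBot (ae (volume.restrict (Metric.ball (0 : Fin N → ℂ) 1))) := by
    rw [ae_neBot, Ne, Measure.restrict_eq_zero]
    exact (Metric.measure_ball_pos volume _ one_pos).ne'
  obtain ⟨y, hy1, hy2⟩ := (hae.and (ae_restrict_mem Metric.isOpen_ball.measurableSet)).exists
  obtain ⟨B, hB1, hB2⟩ := exists_between hy1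
  exact ⟨y, hy2, B, hB2.ne, frequently_lt_of_liminf_lt (by isBoundedDefault) hB1⟩

lemma tsum_eq_top_of_growth (g : ℕ → ℝ≥0∞) (b : ℝ)
    (hg : ∀ k, ENNReal.ofReal (4 ^ k + b) ≤ g k) : ∑' k, (2⁻¹ : ℝ≥0∞) ^ k * g k = ⊤ := by
  refine ENNReal.eq_top_of_forall_nnreal_le ?_
  intro r
  obtain ⟨k, hk⟩ := pow_unbounded_of_one_lt (r + |b|) (one_lt_two : (1 : ℝ) < 2)
  refine le_trans ?_ (ENNReal.le_tsum k)
  have h1 : (2⁻¹ : ℝ≥0∞) ^ k = ENNReal.ofReal ((2⁻¹ : ℝ) ^ k) := by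
    rw [ENNReal.ofReal_pow (by norm_num), ENNReal.ofReal_inv_of_pos two_pos]; simp
  calc (r : ℝ≥0∞) = ENNReal.ofReal r := by simp
    _ ≤ ENNReal.ofReal ((2⁻¹ : ℝ) ^ k * (4 ^ k + b)) := by
        apply ENNReal.ofReal_le_ofReal
        have h2 : (2⁻¹ : ℝ) ^ k * 4 ^ k = 2 ^ k := by rw [← mul_pow]; norm_num
        have h3 : (2⁻¹ : ℝ) ^ k ≤ 1 := pow_le_one₀ (by norm_num) (by norm_num)
        have h4 : -|b| ≤ (2⁻¹ : ℝ) ^ k * b := by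
          have : |(2⁻¹ : ℝ) ^ k * b| ≤ |b| := by
            rw [abs_mul, abs_of_nonneg (by positivity)]
            exact mul_le_of_le_one_left (abs_nonneg _) h3
          exact (abs_le.1 (this)).1
        rw [mul_add, h2]; linarith
    _ = (2⁻¹ : ℝ≥0∞) ^ k * ENNReal.ofReal (4 ^ k + b) := by
        rw [ENNReal.ofReal_mul (by positivity), h1]
    _ ≤ _ := by gcongr; exact hg k

/-- The weighted Chebyshev norms decay at most geometrically, since otherwise `{w > 0}` would be
pluripolar. -/
theorem IsAdmissibleWeight.exists_pow_le_supNorm {E : Set (Fin N → ℂ)} (hE : IsCompact E)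
    {w : (Fin N → ℂ) → ℝ} (hw : IsAdmissibleWeight E w) :
    ∃ c : ℝ, 0 < c ∧ ∀ α : Fin N →₀ ℕ, ∀ q ∈ monicClass α,
      c ^ α.degree ≤ supNorm E w α.degree q := by
  by_contra! hcon
  have h := fun j : ℕ => hcon (Real.exp (-4 ^ j)) (Real.exp_pos _)
  choose α q hq hlt using h
  have hd : ∀ j, (α j).degree ≠ 0 := by
    intro j hj
    obtain ⟨z, hz⟩ := hw.nonempty
    have h1 := hlt j
    rw [hj] at h1
    have h2 := hw.le_supNorm hE 0 (q j) hz
    rw [eq_one_of_mem_monicClass (hq j) hj] at h1 h2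
    simp at h1 h2
    linarith
  refine hw.not_pluripolar fun a ha => ?_
  set R : ℝ := ‖a‖ + 3 with hR
  have hR1 : 1 ≤ R := by have := norm_nonneg a; linarith
  have hR3 : 3 ≤ R := by have := norm_nonneg a; linarith
  choose s hs hx hle using fun j => exists_normalization (hq j) hR1
  obtain ⟨y, hy, B, hB, hfreq⟩ := exists_mem_ball_frequently_le s (fun j => (α j).degree) hd
    (κ := (2 ^ N * R)⁻¹) (by positivity) (fun j z hz => hs j z (Metric.ball_subset_ball hR3 hz)) hx
  -- Along `φ` the terms are bounded by `B` at `y`, whereas on `{w > 0}` they grow like `4 ^ k`; the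
  -- weights `2 ^ (-k)` separate the two.
  obtain ⟨φ, hφ, hφB⟩ := extraction_of_frequently_atTop hfreq
  set d : ℕ → ℕ := fun k => (α (φ k)).degree with hdd
  have hd0 : ∀ k, (d k : ℝ≥0∞) ≠ 0 := fun k => by exact_mod_cast hd (φ k)
  have hdt : ∀ k, (d k : ℝ≥0∞) ≠ ⊤ := fun k => ENNReal.natCast_ne_top _
  refine ⟨Metric.ball 0 R, Metric.isOpen_ball, ?_, _,
    isPSH_neg_tsum_logDefect (fun k => s (φ k)) (fun k => 2⁻¹ ^ k * (d k : ℝ≥0∞)⁻¹) ?_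
      (fun k => hs (φ k)) (y := y) (Metric.ball_subset_ball hR1 hy) ?_, ?_⟩
  · rw [mem_ball_zero_iff]; linarith
  · intro k
    exact ENNReal.mul_ne_top (ENNReal.pow_ne_top (by simp)) (ENNReal.inv_ne_top.2 (hd0 k))
  · have h1 : ∑' k : ℕ, (2⁻¹ : ℝ≥0∞) ^ k * B ≠ ⊤ := by
      rw [ENNReal.tsum_mul_right, ENNReal.tsum_geometric]
      refine ENNReal.mul_ne_top ?_ hB
      simp
    refine ne_top_of_le_ne_top h1 (ENNReal.tsum_le_tsum fun k => ?_)
    rw [mul_assoc]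
    gcongr
    exact (hφB k).le
  · rintro z ⟨⟨hzE, hzw⟩, -⟩
    simp only [mul_assoc]
    rw [tsum_eq_top_of_growth _ (Real.log (w z))]
    · rfl
    intro k
    set t : ℝ := Real.exp (-4 ^ φ k) * (w z)⁻¹ with ht
    have ht0 : 0 < t := by positivity
    have h1 : ‖MvPolynomial.eval z (s (φ k))‖ ≤ t ^ d k := by
      refine (hle (φ k) z).trans ?_
      rw [ht, mul_pow, inv_pow, ← div_eq_mul_inv, le_div_iff₀ (pow_pos hzw _), mul_comm]
      exact (hw.le_supNorm hE _ _ hzE).trans (hlt (φ k)).le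
    have h2 : (d k : ℝ≥0∞) * ENNReal.ofReal (-Real.log t) ≤
        logDefect ‖MvPolynomial.eval z (s (φ k))‖ₑ := by
      rw [← logDefect_ofReal_pow ht0, ← ofReal_norm]
      exact logDefect_anti (ENNReal.ofReal_le_ofReal h1)
    have h3 : (4 : ℝ) ^ k + Real.log (w z) ≤ -Real.log t := by
      rw [ht, Real.log_mul (Real.exp_pos _).ne' (inv_pos.2 hzw).ne', Real.log_exp, Real.log_inv]
      have : (4 : ℝ) ^ k ≤ 4 ^ φ k := pow_le_pow_right₀ (by norm_num) (hφ.id_le k)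
      linarith
    calc ENNReal.ofReal (4 ^ k + Real.log (w z)) ≤ ENNReal.ofReal (-Real.log t) :=
          ENNReal.ofReal_le_ofReal h3
      _ = (d k : ℝ≥0∞)⁻¹ * (d k * ENNReal.ofReal (-Real.log t)) := by
          rw [← mul_assoc, ENNReal.inv_mul_cancel (hd0 k) (hdt k), one_mul]
      _ ≤ _ := by gcongr

/-! ### Submultiplicativity of the minimal norms -/

/-- `P(α)` in the terms of Mathlib's monomial orders. -/
lemma mem_monicClass_iff {α : Fin N →₀ ℕ} {q : MvPolynomial (Fin N) ℂ} :
    q ∈ monicClass α ↔ MonomialOrder.degLex.degree q = α ∧ MonomialOrder.degLex.Monic q := by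
  constructor
  · rintro ⟨h1, h2⟩
    have hdeg : MonomialOrder.degLex.degree q = α := by
      apply MonomialOrder.degLex.toSyn.injective
      apply le_antisymm
      · rw [MonomialOrder.degree_le_iff]
        intro β hβ
        rw [MonomialOrder.degLex_le_iff]
        by_cases h : β = α
        · rw [h]
        · exact (h2 β h (MvPolynomial.mem_support_iff.1 hβ)).le
      · exact MonomialOrder.le_degree (by simp [h1])
    exact ⟨hdeg, by rw [MonomialOrder.Monic, MonomialOrder.leadingCoeff, hdeg, h1]⟩
  · rintro ⟨h1, h2⟩
    refine ⟨by rw [← h1]; exact h2, fun β hβ hc => ?_⟩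
    have := MonomialOrder.degLex.le_degree (MvPolynomial.mem_support_iff.2 hc)
    rw [h1, MonomialOrder.degLex_le_iff] at this
    exact lt_of_le_of_ne this hβ

lemma mul_mem_monicClass {α β : Fin N →₀ ℕ} {p q : MvPolynomial (Fin N) ℂ} (hp : p ∈ monicClass α)
    (hq : q ∈ monicClass β) : p * q ∈ monicClass (α + β) := by
  rw [mem_monicClass_iff] at *
  obtain ⟨rfl, hp⟩ := hp
  obtain ⟨rfl, hq⟩ := hq
  exact ⟨MonomialOrder.degree_mul hp.ne_zero hq.ne_zero, hp.mul hq⟩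

lemma monomial_mem_monicClass (α : Fin N →₀ ℕ) : MvPolynomial.monomial α 1 ∈ monicClass α := by
  classical
  refine ⟨by simp, fun β hβ h => ?_⟩
  simp [MvPolynomial.coeff_monomial, hβ.symm] at h

lemma supNorm_nonneg {E : Set (Fin N → ℂ)} {w : (Fin N → ℂ) → ℝ} (hw : IsAdmissibleWeight E w)
    (d : ℕ) (p : MvPolynomial (Fin N) ℂ) : 0 ≤ supNorm E w d p := by
  apply Real.sSup_nonneg
  rintro _ ⟨z, hz, rfl⟩
  have := hw.nonneg z hz
  positivity

lemma supNorm_le {E : Set (Fin N → ℂ)} {w : (Fin N → ℂ) → ℝ} (hw : IsAdmissibleWeight E w)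
    {d : ℕ} {p : MvPolynomial (Fin N) ℂ} {M : ℝ}
    (h : ∀ z ∈ E, w z ^ d * ‖MvPolynomial.eval z p‖ ≤ M) : supNorm E w d p ≤ M := by
  apply csSup_le (hw.nonempty.image _)
  rintro _ ⟨z, hz, rfl⟩
  exact h z hz

lemma supNorm_mul_le {E : Set (Fin N → ℂ)} (hE : IsCompact E) {w : (Fin N → ℂ) → ℝ}
    (hw : IsAdmissibleWeight E w) (d e : ℕ) (p q : MvPolynomial (Fin N) ℂ) :
    supNorm E w (d + e) (p * q) ≤ supNorm E w d p * supNorm E w e q := by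
  refine supNorm_le hw fun z hz => ?_
  have h0 := hw.nonneg z hz
  calc w z ^ (d + e) * ‖MvPolynomial.eval z (p * q)‖
      = (w z ^ d * ‖MvPolynomial.eval z p‖) * (w z ^ e * ‖MvPolynomial.eval z q‖) := by
        rw [map_mul, norm_mul, pow_add]; ring
    _ ≤ _ := mul_le_mul (hw.le_supNorm hE d p hz) (hw.le_supNorm hE e q hz) (by positivity)
        (supNorm_nonneg hw d p)

lemma chebyshevNorm_le {E : Set (Fin N → ℂ)} {w : (Fin N → ℂ) → ℝ} (hw : IsAdmissibleWeight E w)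
    {α : Fin N →₀ ℕ} {q : MvPolynomial (Fin N) ℂ} (hq : q ∈ monicClass α) :
    chebyshevNorm E w α ≤ supNorm E w α.degree q := by
  refine csInf_le ⟨0, ?_⟩ ⟨q, hq, rfl⟩
  rintro _ ⟨p, -, rfl⟩
  exact supNorm_nonneg hw _ p

lemma le_chebyshevNorm {E : Set (Fin N → ℂ)} {w : (Fin N → ℂ) → ℝ} {α : Fin N →₀ ℕ} {M : ℝ}
    (h : ∀ q ∈ monicClass α, M ≤ supNorm E w α.degree q) : M ≤ chebyshevNorm E w α := by
  refine le_csInf (Set.Nonempty.image _ ⟨_, monomial_mem_monicClass α⟩) ?_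
  rintro _ ⟨p, hp, rfl⟩
  exact h p hp

lemma chebyshevNorm_add_le {E : Set (Fin N → ℂ)} (hE : IsCompact E) {w : (Fin N → ℂ) → ℝ}
    (hw : IsAdmissibleWeight E w) (α β : Fin N →₀ ℕ) :
    chebyshevNorm E w (α + β) ≤ chebyshevNorm E w α * chebyshevNorm E w β := by
  obtain ⟨c, hc, hcle⟩ := hw.exists_pow_le_supNorm hE
  have hpos : ∀ γ : Fin N →₀ ℕ, ∀ q ∈ monicClass γ, 0 < supNorm E w γ.degree q := fun γ q hq =>
    (pow_pos hc _).trans_le (hcle γ q hq)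
  have hYpos : 0 < chebyshevNorm E w α := (pow_pos hc _).trans_le (le_chebyshevNorm (hcle α))
  have h1 : ∀ p ∈ monicClass α, ∀ q ∈ monicClass β, chebyshevNorm E w (α + β) ≤
      supNorm E w α.degree p * supNorm E w β.degree q := by
    intro p hp q hq
    refine (chebyshevNorm_le hw (mul_mem_monicClass hp hq)).trans ?_
    rw [map_add]
    exact supNorm_mul_le hE hw _ _ p q
  have h2 : ∀ q ∈ monicClass β,
      chebyshevNorm E w (α + β) ≤ chebyshevNorm E w α * supNorm E w β.degree q := by
    intro q hq
    rw [← div_le_iff₀ (hpos β q hq)]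
    refine le_chebyshevNorm fun p hp => ?_
    rw [div_le_iff₀ (hpos β q hq)]
    exact h1 p hp q hq
  rw [← div_le_iff₀' hYpos]
  refine le_chebyshevNorm fun q hq => ?_
  rw [div_le_iff₀' hYpos]
  exact h2 q hq

lemma exists_chebyshevNorm_le_pow {E : Set (Fin N → ℂ)} (hE : IsCompact E) {w : (Fin N → ℂ) → ℝ}
    (hw : IsAdmissibleWeight E w) :
    ∃ A : ℝ, 0 < A ∧ ∀ α : Fin N →₀ ℕ, chebyshevNorm E w α ≤ A ^ α.degree := by
  obtain ⟨W, hW1, hW⟩ := hw.exists_bound hE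
  obtain ⟨K, hK0, hK⟩ := hE.isBounded.exists_pos_norm_le
  refine ⟨W * K, by positivity, fun α => ?_⟩
  refine (chebyshevNorm_le hw (monomial_mem_monicClass α)).trans (supNorm_le hw fun z hz => ?_)
  have h0 := hw.nonneg z hz
  rw [mul_pow]
  apply mul_le_mul (pow_le_pow_left₀ h0 (hW z hz) _) _ (norm_nonneg _) (by positivity)
  rw [MvPolynomial.eval_monomial, one_mul, Finsupp.prod_fintype _ _ (by simp), norm_prod]
  calc ∏ i, ‖z i ^ α i‖ ≤ ∏ i, K ^ α i := by
        apply Finset.prod_le_prod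
        · intros; positivity
        · intro i _
          rw [norm_pow]
          exact pow_le_pow_left₀ (norm_nonneg _) ((norm_le_pi_norm z i).trans (hK z hz)) _
    _ = K ^ α.degree := by rw [Finset.prod_pow_eq_pow_sum, Finsupp.degree_eq_sum]

/-! ### Subadditive functions on multi-indices -/

/-- The filter of multi-indices `α` with `|α| → ∞` and `α / |α| → θ`. -/
def directionFilter (θ : Fin N → ℝ) : Filter (Fin N →₀ ℕ) :=
  comap Finsupp.degree atTop ⊓ comap (fun α i => (α i : ℝ) / (α.degree : ℝ)) (𝓝 θ)

lemma HasDirection.tendsto {α : ℕ → (Fin N →₀ ℕ)} {θ : Fin N → ℝ} (h : HasDirection α θ) :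
    Tendsto α atTop (directionFilter θ) :=
  tendsto_inf.2 ⟨tendsto_comap_iff.2 h.1, tendsto_comap_iff.2 h.2⟩

lemma subadditive_nsmul_le {f : (Fin N →₀ ℕ) → ℝ} (hsub : ∀ α β, f (α + β) ≤ f α + f β) {C : ℝ}
    (hC : ∀ α, |f α| ≤ C * α.degree) (m : ℕ) (α : Fin N →₀ ℕ) : f (m • α) ≤ m * f α := by
  induction m with
  | zero => simpa using (le_abs_self _).trans (hC 0)
  | succ m ih =>
    rw [succ_nsmul]
    push_cast
    linarith [hsub (m • α) α]

/-- Division with remainder: `β = m α + r` with `|r| ≤ 3 η |β|`, where `m` is the integer part of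
`(1 - 2 η) |β| / |α|`. Positivity of `θ` guarantees that `m α ≤ β` in every coordinate. -/
lemma subadditive_div_degree_le {f : (Fin N →₀ ℕ) → ℝ} (hsub : ∀ α β, f (α + β) ≤ f α + f β) {C : ℝ}
    (hC : ∀ α, |f α| ≤ C * α.degree) {θ : Fin N → ℝ} (hθ : ∀ i, 0 < θ i) (hC0 : 0 ≤ C) {η : ℝ}
    (hη : 0 < η) (hη' : η < 1 / 3) {α β : Fin N →₀ ℕ} (hα0 : 0 < α.degree)
    (hα : ∀ i, (α i : ℝ) ≤ (1 + η) * θ i * α.degree)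
    (hβ : ∀ i, (1 - η) * θ i * β.degree ≤ β i) (hαβ : (α.degree : ℝ) ≤ η * β.degree) :
    f β / β.degree ≤ f α / α.degree + 6 * C * η := by
  set a : ℝ := (α.degree : ℝ) with ha
  set b : ℝ := (β.degree : ℝ) with hb
  have ha0 : 0 < a := by rw [ha]; exact_mod_cast hα0
  have hb0 : 0 < b := by
    by_contra h
    nlinarith
  set m : ℕ := ⌊(1 - 2 * η) * b / a⌋₊ with hm
  have hm1 : (m : ℝ) * a ≤ (1 - 2 * η) * b := by
    rw [← le_div_iff₀ ha0]
    exact Nat.floor_le (by apply div_nonneg _ ha0.le; nlinarith)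
  have hm2 : (1 - 2 * η) * b - a ≤ m * a := by
    have := (Nat.lt_floor_add_one ((1 - 2 * η) * b / a)).le
    rw [div_le_iff₀ ha0] at this
    linarith
  have hle : m • α ≤ β := by
    intro i
    have h1 : (m : ℝ) * α i ≤ β i := by
      have hθi := hθ i
      calc (m : ℝ) * α i ≤ m * ((1 + η) * θ i * a) := by gcongr; exact hα i
        _ = (1 + η) * θ i * (m * a) := by ring
        _ ≤ (1 + η) * θ i * ((1 - 2 * η) * b) := by gcongr
        _ = (1 - η - 2 * η ^ 2) * (θ i * b) := by ring
        _ ≤ (1 - η) * (θ i * b) := by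
            apply mul_le_mul_of_nonneg_right _ (by positivity)
            linarith [sq_nonneg η]
        _ ≤ β i := by rw [← mul_assoc]; exact hβ i
    have : m * α i ≤ β i := by exact_mod_cast h1
    simpa using this
  obtain ⟨r, hβr⟩ := exists_add_of_le hle
  have hbr : b = m * a + r.degree := by
    rw [hb, hβr, map_add, map_nsmul]; push_cast; simp [ha]
  have hr : (r.degree : ℝ) ≤ 3 * η * b := by linarith
  have hf : f β ≤ m * f α + C * (3 * η * b) := by
    rw [hβr]
    have h1 := hsub (m • α) r
    have h2 := subadditive_nsmul_le hsub hC m α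
    have h3 := (le_abs_self _).trans (hC r)
    have h4 : C * (r.degree : ℝ) ≤ C * (3 * η * b) := by gcongr
    linarith
  have hfa : -(C * a) ≤ f α := (abs_le.1 (hC α)).1
  rw [div_le_iff₀ hb0]
  have key : (m : ℝ) * f α ≤ f α / a * b + 3 * C * η * b := by
    have e1 : (m : ℝ) * f α = f α / a * (m * a) := by field_simp
    have e2 : -C ≤ f α / a := by rw [le_div_iff₀ ha0]; linarith
    have e3 : 0 ≤ b - m * a := by nlinarith
    have e4 : b - m * a ≤ 3 * η * b := by linarith
    have e5 : C * (b - m * a) ≤ C * (3 * η * b) := by gcongr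
    nlinarith [mul_le_mul_of_nonneg_right e2 e3]
  nlinarith

theorem subadditive_exists_tendsto_div_degree {f : (Fin N →₀ ℕ) → ℝ}
    (hsub : ∀ α β, f (α + β) ≤ f α + f β) {C : ℝ}
    (hC : ∀ α, |f α| ≤ C * α.degree) {θ : Fin N → ℝ} (hθ : ∀ i, 0 < θ i) :
    ∃ L, Tendsto (fun α => f α / (α.degree : ℝ)) (directionFilter θ) (𝓝 L) := by
  -- `limsup` and `liminf` over the trivial filter are junk values, so that case is treated apart.
  rcases eq_or_neBot (directionFilter θ) with hbot | hne
  · exact ⟨0, by rw [hbot]; exact tendsto_bot⟩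
  wlog hC0 : 0 ≤ C generalizing C
  · refine this (C := |C|) (fun α => (hC α).trans ?_) (abs_nonneg C)
    gcongr
    exact le_abs_self C
  set g : (Fin N →₀ ℕ) → ℝ := fun α => f α / (α.degree : ℝ) with hg
  have hgC : ∀ α, |g α| ≤ C := by
    intro α
    simp only [hg, abs_div, Nat.abs_cast]
    exact div_le_of_le_mul₀ (by positivity) hC0 (hC α)
  have hdeg : Tendsto (fun α : Fin N →₀ ℕ => α.degree) (directionFilter θ) atTop :=
    tendsto_comap.mono_left inf_le_left
  have hdir : ∀ i, Tendsto (fun α : Fin N →₀ ℕ => (α i : ℝ) / (α.degree : ℝ)) (directionFilter θ)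
      (𝓝 (θ i)) := fun i =>
    ((continuous_apply i).tendsto θ).comp (tendsto_comap.mono_left inf_le_right)
  have hb1 : IsBoundedUnder (· ≤ ·) (directionFilter θ) g :=
    isBoundedUnder_of ⟨C, fun α => (abs_le.1 (hgC α)).2⟩
  have hb2 : IsBoundedUnder (· ≥ ·) (directionFilter θ) g :=
    isBoundedUnder_of ⟨-C, fun α => (abs_le.1 (hgC α)).1⟩
  refine ⟨limsup g (directionFilter θ), tendsto_of_le_liminf_of_limsup_le ?_ le_rfl hb1 hb2⟩
  refine le_of_forall_pos_sub_le fun ε hε => ?_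
  obtain ⟨η, hη0, hη1, hηε⟩ : ∃ η : ℝ, 0 < η ∧ η < 1 / 3 ∧ 6 * C * η ≤ ε := by
    refine ⟨min (1 / 4) (ε / (6 * C + 1)), by positivity, ?_, ?_⟩
    · exact (min_le_left _ _).trans_lt (by norm_num)
    · have h1 : min (1 / 4) (ε / (6 * C + 1)) ≤ ε / (6 * C + 1) := min_le_right _ _
      have h2 : 6 * C * (ε / (6 * C + 1)) ≤ ε := by
        rw [mul_div_assoc', div_le_iff₀ (by positivity)]
        nlinarith
      nlinarith
  have hev : ∀ᶠ α in directionFilter θ, 0 < α.degree ∧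
      (∀ i, (α i : ℝ) ≤ (1 + η) * θ i * α.degree) ∧ ∀ i, (1 - η) * θ i * α.degree ≤ α i := by
    have h1 : ∀ᶠ α in directionFilter θ, ∀ i, (α i : ℝ) / (α.degree : ℝ) ≤ (1 + η) * θ i :=
      eventually_all.2 fun i => (hdir i).eventually_le_const (by nlinarith [hθ i])
    have h2 : ∀ᶠ α in directionFilter θ, ∀ i, (1 - η) * θ i ≤ (α i : ℝ) / (α.degree : ℝ) :=
      eventually_all.2 fun i => (hdir i).eventually_const_le (by nlinarith [hθ i])
    filter_upwards [h1, h2, hdeg.eventually_gt_atTop 0] with α h1 h2 h3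
    have h4 : (0 : ℝ) < α.degree := by exact_mod_cast h3
    exact ⟨h3, fun i => (div_le_iff₀ h4).1 (h1 i), fun i => (le_div_iff₀ h4).1 (h2 i)⟩
  refine le_liminf_of_le hb1.isCoboundedUnder_ge ?_
  filter_upwards [hev] with α hα
  rw [sub_le_iff_le_add]
  refine limsup_le_of_le hb2.isCoboundedUnder_le ?_
  have hlarge : ∀ᶠ β in directionFilter θ, (α.degree : ℝ) ≤ η * β.degree := by
    have := (tendsto_natCast_atTop_atTop (R := ℝ)).comp hdeg
    exact (this.const_mul_atTop hη0).eventually_ge_atTop _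
  filter_upwards [hev, hlarge] with β hβ hβ2
  exact (subadditive_div_degree_le hsub hC hθ hC0 hη0 hη1 hα.1 hα.2.1 hβ.2.2 hβ2).trans (by
    simp only [hg]; linarith)

/-! ### The limit of the logarithmic minimal norms -/

theorem exists_tendsto_log_chebyshevNorm {E : Set (Fin N → ℂ)} (hE : IsCompact E)
    {w : (Fin N → ℂ) → ℝ} (hw : IsAdmissibleWeight E w) {θ : Fin N → ℝ} (hθ : ∀ i, 0 < θ i) :
    (∀ α, 0 < chebyshevNorm E w α) ∧
    ∃ L, Tendsto (fun α => Real.log (chebyshevNorm E w α) / (α.degree : ℝ)) (directionFilter θ)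
      (𝓝 L) := by
  obtain ⟨c, hc, hcle⟩ := hw.exists_pow_le_supNorm hE
  obtain ⟨A, hA, hAle⟩ := exists_chebyshevNorm_le_pow hE hw
  have hlow : ∀ α, c ^ α.degree ≤ chebyshevNorm E w α := fun α => le_chebyshevNorm (hcle α)
  have hpos : ∀ α, 0 < chebyshevNorm E w α := fun α => (pow_pos hc _).trans_le (hlow α)
  refine ⟨hpos, subadditive_exists_tendsto_div_degree (C := max |Real.log c| |Real.log A|)
    (f := fun α => Real.log (chebyshevNorm E w α)) ?_ ?_ hθ⟩
  · intro α β
    rw [← Real.log_mul (hpos α).ne' (hpos β).ne']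
    exact Real.log_le_log (hpos _) (chebyshevNorm_add_le hE hw α β)
  · intro α
    have h1 := Real.log_le_log (pow_pos hc _) (hlow α)
    have h2 := Real.log_le_log (hpos α) (hAle α)
    rw [Real.log_pow] at h1 h2
    have hd : (0 : ℝ) ≤ α.degree := Nat.cast_nonneg _
    have h3 : -(max |Real.log c| |Real.log A|) ≤ Real.log c :=
      (neg_le_neg (le_max_left _ _)).trans (neg_abs_le _)
    have h4 : Real.log A ≤ max |Real.log c| |Real.log A| := (le_abs_self _).trans (le_max_right _ _)
    rw [abs_le]
    constructor <;> nlinarith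

/-! ### The weighted inner product on polynomials -/

/-- The inner product of `L²(w^{2d} μ)` on polynomials, linear in the first argument, as in
`IsOrthonormalFamily`. -/
def weightedInner (w : (Fin N → ℂ) → ℝ) (μ : Measure (Fin N → ℂ)) (d : ℕ)
    (p q : MvPolynomial (Fin N) ℂ) : ℂ :=
  ∫ z, MvPolynomial.eval z p * (starRingEnd ℂ) (MvPolynomial.eval z q) * ((w z : ℂ) ^ (2 * d)) ∂μ

section Integrability

variable {E : Set (Fin N → ℂ)} {w : (Fin N → ℂ) → ℝ} {μ : Measure (Fin N → ℂ)}

lemma ae_mem_of_support_eq (hμ : μ.support = E) : ∀ᵐ z ∂μ, z ∈ E := by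
  rw [← hμ]; exact Measure.support_mem_ae

lemma IsAdmissibleWeight.aemeasurable (hE : IsCompact E) (hw : IsAdmissibleWeight E w)
    (hμ : μ.support = E) : AEMeasurable w μ := by
  rw [← Measure.restrict_eq_self_of_ae_mem (ae_mem_of_support_eq hμ)]
  rw [aemeasurable_restrict_iff_comap_subtype hE.measurableSet]
  exact (upperSemicontinuousOn_iff_restrict.2 hw.usc).measurable.aemeasurable

variable [IsFiniteMeasure μ]

lemma IsAdmissibleWeight.integrable_weightedInner (hE : IsCompact E) (hw : IsAdmissibleWeight E w)
    (hμ : μ.support = E) (d : ℕ) (p q : MvPolynomial (Fin N) ℂ) :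
    Integrable (fun z => MvPolynomial.eval z p * (starRingEnd ℂ) (MvPolynomial.eval z q) *
      ((w z : ℂ) ^ (2 * d))) μ := by
  obtain ⟨W, hW1, hW⟩ := hw.exists_bound hE
  obtain ⟨K, hK⟩ := hE.exists_bound_of_continuousOn
    (f := fun z => MvPolynomial.eval z p * (starRingEnd ℂ) (MvPolynomial.eval z q))
    ((MvPolynomial.continuous_eval p).mul
      (Complex.continuous_conj.comp (MvPolynomial.continuous_eval q))).continuousOn
  have hm := hw.aemeasurable hE hμ
  refine Integrable.of_bound (C := K * W ^ (2 * d)) ?_ ?_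
  · refine AEStronglyMeasurable.mul ?_ ?_
    · exact ((MvPolynomial.continuous_eval p).mul
        (Complex.continuous_conj.comp (MvPolynomial.continuous_eval q))).aestronglyMeasurable
    · exact ((Complex.measurable_ofReal.comp_aemeasurable hm).pow_const _).aestronglyMeasurable
  · filter_upwards [ae_mem_of_support_eq hμ] with z hz
    have h0 := hw.nonneg z hz
    rw [norm_mul, norm_pow, Complex.norm_real, Real.norm_of_nonneg h0]
    exact mul_le_mul (hK z hz) (pow_le_pow_left₀ h0 (hW z hz) _) (by positivity)
      ((norm_nonneg _).trans (hK z hz))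

lemma weightedInner_add_left (hE : IsCompact E) (hw : IsAdmissibleWeight E w)
    (hμ : μ.support = E) (d : ℕ) (p q r : MvPolynomial (Fin N) ℂ) :
    weightedInner w μ d (p + q) r = weightedInner w μ d p r + weightedInner w μ d q r := by
  simp only [weightedInner]
  rw [← integral_add (hw.integrable_weightedInner hE hμ d p r)
    (hw.integrable_weightedInner hE hμ d q r)]
  congr 1
  ext z
  rw [map_add]; ring

omit [IsFiniteMeasure μ] in
lemma weightedInner_smul_left (d : ℕ) (c : ℂ) (p q : MvPolynomial (Fin N) ℂ) :
    weightedInner w μ d (c • p) q = c * weightedInner w μ d p q := by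
  simp only [weightedInner]
  rw [← integral_const_mul]
  congr 1
  ext z
  rw [MvPolynomial.smul_eval]; ring

omit [IsFiniteMeasure μ] in
lemma conj_weightedInner (d : ℕ) (p q : MvPolynomial (Fin N) ℂ) :
    (starRingEnd ℂ) (weightedInner w μ d p q) = weightedInner w μ d q p := by
  simp only [weightedInner]
  rw [← integral_conj]
  congr 1
  ext z
  simp only [map_mul, map_pow, Complex.conj_conj, Complex.conj_ofReal]
  ring

omit [IsFiniteMeasure μ] in
lemma weightedInner_self (d : ℕ) (p : MvPolynomial (Fin N) ℂ) :
    weightedInner w μ d p p = ((l2Norm w μ d p ^ 2 : ℝ) : ℂ) := by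
  rw [l2Norm, Real.sq_sqrt (integral_nonneg fun z => sq_nonneg _), ← integral_complex_ofReal,
    weightedInner]
  congr 1
  ext z
  rw [Complex.mul_conj, Complex.normSq_eq_norm_sq]
  push_cast
  ring

lemma weightedInner_eq_zero_of_coeff (hE : IsCompact E) (hw : IsAdmissibleWeight E w)
    (hμ : μ.support = E) (d : ℕ) {g r : MvPolynomial (Fin N) ℂ}
    (h : ∀ β, g.coeff β ≠ 0 → weightedInner w μ d (MvPolynomial.monomial β 1) r = 0) :
    weightedInner w μ d g r = 0 := by
  let φ : MvPolynomial (Fin N) ℂ →ₗ[ℂ] ℂ :=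
    { toFun := fun p => weightedInner w μ d p r
      map_add' := fun p q => weightedInner_add_left hE hw hμ d p q r
      map_smul' := fun c p => weightedInner_smul_left d c p r }
  change φ g = 0
  rw [g.as_sum, map_sum]
  refine Finset.sum_eq_zero fun β hβ => ?_
  have h1 : MvPolynomial.monomial β (g.coeff β) = g.coeff β • MvPolynomial.monomial β (1 : ℂ) := by
    rw [MvPolynomial.smul_monomial]; simp
  rw [h1, map_smul]
  have : φ (MvPolynomial.monomial β 1) = 0 := h β (MvPolynomial.mem_support_iff.1 hβ)
  rw [this, smul_zero]

omit [IsFiniteMeasure μ] in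
lemma l2Norm_nonneg (d : ℕ) (p : MvPolynomial (Fin N) ℂ) : 0 ≤ l2Norm w μ d p := Real.sqrt_nonneg _

omit [IsFiniteMeasure μ] in
lemma l2Norm_smul (d : ℕ) (c : ℂ) (p : MvPolynomial (Fin N) ℂ) :
    l2Norm w μ d (c • p) = ‖c‖ * l2Norm w μ d p := by
  have h : ∀ z, (w z ^ d * ‖MvPolynomial.eval z (c • p)‖) ^ 2 =
      ‖c‖ ^ 2 * (w z ^ d * ‖MvPolynomial.eval z p‖) ^ 2 := fun z => by
    rw [MvPolynomial.smul_eval, norm_mul]; ring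
  simp only [l2Norm, h]
  rw [integral_const_mul, Real.sqrt_mul (sq_nonneg _), Real.sqrt_sq (norm_nonneg c)]

lemma integrable_sq (hE : IsCompact E) (hw : IsAdmissibleWeight E w) (hμ : μ.support = E) (d : ℕ)
    (p : MvPolynomial (Fin N) ℂ) :
    Integrable (fun z => (w z ^ d * ‖MvPolynomial.eval z p‖) ^ 2) μ := by
  refine (hw.integrable_weightedInner hE hμ d p p).re.congr (Eventually.of_forall fun z => ?_)
  simp only [RCLike.re_to_complex]
  rw [Complex.mul_conj, Complex.normSq_eq_norm_sq, ← Complex.ofReal_pow, ← Complex.ofReal_mul,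
    Complex.ofReal_re]
  ring

lemma l2Norm_le_supNorm (hE : IsCompact E) (hw : IsAdmissibleWeight E w) (hμ : μ.support = E)
    (d : ℕ) (p : MvPolynomial (Fin N) ℂ) :
    l2Norm w μ d p ≤ Real.sqrt (μ.real Set.univ) * supNorm E w d p := by
  rw [l2Norm, Real.sqrt_le_left (by have := supNorm_nonneg hw d p; positivity), mul_pow,
    Real.sq_sqrt measureReal_nonneg]
  calc ∫ z, (w z ^ d * ‖MvPolynomial.eval z p‖) ^ 2 ∂μ ≤ ∫ _, supNorm E w d p ^ 2 ∂μ := by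
        apply integral_mono_ae (integrable_sq hE hw hμ d p) (integrable_const _)
        filter_upwards [ae_mem_of_support_eq hμ] with z hz
        have h0 := hw.nonneg z hz
        exact pow_le_pow_left₀ (by positivity) (hw.le_supNorm hE d p hz) 2
    _ = μ.real Set.univ * supNorm E w d p ^ 2 := by simp

omit μ [IsFiniteMeasure μ] in
/-- The set `{w > 0}` is a set of uniqueness for polynomials: a nonzero polynomial vanishing on it
would, divided by its leading coefficient, contradict the lower bound for the weighted norms. -/
lemma IsAdmissibleWeight.eq_zero_of_eval_eq_zero (hE : IsCompact E) (hw : IsAdmissibleWeight E w)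
    {p : MvPolynomial (Fin N) ℂ} (hp : ∀ z ∈ E, 0 < w z → MvPolynomial.eval z p = 0) : p = 0 := by
  by_contra hp0
  set m := MonomialOrder.degLex (σ := Fin N)
  have hlc : m.leadingCoeff p ≠ 0 := m.leadingCoeff_ne_zero_iff.2 hp0
  set q := MvPolynomial.C (m.leadingCoeff p)⁻¹ * p with hq
  have hqm : q ∈ monicClass (m.degree p) := by
    refine ⟨?_, fun β hβ hc => ?_⟩
    · rw [hq, MvPolynomial.coeff_C_mul]
      exact inv_mul_cancel₀ hlc
    · rw [hq, MvPolynomial.coeff_C_mul] at hc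
      have := m.le_degree (MvPolynomial.mem_support_iff.2 (right_ne_zero_of_mul hc))
      exact lt_of_le_of_ne (MonomialOrder.degLex_le_iff.1 this) hβ
  have hq0 : ∀ z ∈ E, 0 < w z → MvPolynomial.eval z q = 0 := fun z hz hwz => by
    rw [hq, map_mul, hp z hz hwz, mul_zero]
  obtain ⟨c, hc, hle⟩ := hw.exists_pow_le_supNorm hE
  have h1 := hle _ q hqm
  by_cases hd : (m.degree p).degree = 0
  · have hq1 := eq_one_of_mem_monicClass hqm hd
    obtain ⟨z, hz, hwz⟩ : {z ∈ E | 0 < w z}.Nonempty := by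
      by_contra hne
      exact hw.not_pluripolar fun a ha => absurd ⟨a, ha⟩ hne
    have := hq0 z hz hwz
    rw [hq1] at this
    simp at this
  · have h2 : supNorm E w (m.degree p).degree q ≤ 0 := supNorm_le hw fun z hz => by
      rcases (hw.nonneg z hz).eq_or_lt with h | h
      · rw [← h, zero_pow hd, zero_mul]
      · rw [hq0 z hz h, norm_zero, mul_zero]
    exact absurd (pow_pos hc _) (not_lt.2 (h1.trans h2))

/-- Definiteness of the inner product, also for polynomials of degree greater than `d`. -/
lemma eq_zero_of_l2Norm_eq_zero (hE : IsCompact E) (hw : IsAdmissibleWeight E w)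
    (hμ : μ.support = E) (hBM : WeightedBernsteinMarkov E w μ) {d : ℕ}
    {p : MvPolynomial (Fin N) ℂ} (hp : l2Norm w μ d p = 0) : p = 0 := by
  have hae : ∀ᵐ z ∂μ, w z ^ d * ‖MvPolynomial.eval z p‖ = 0 := by
    rw [l2Norm, Real.sqrt_eq_zero (integral_nonneg fun z => sq_nonneg _),
      integral_eq_zero_iff_of_nonneg (fun z => sq_nonneg _) (integrable_sq hE hw hμ d p)] at hp
    filter_upwards [hp] with z hz
    exact pow_eq_zero_iff two_ne_zero |>.1 hz
  -- The Bernstein–Markov inequality of index `d` covers only degrees at most `d`, but `p` has norm zero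
  -- for every index beyond `d` as well.
  set D := d + p.totalDegree with hD
  have h2 : l2Norm w μ D p = 0 := by
    rw [l2Norm, integral_eq_zero_of_ae, Real.sqrt_zero]
    filter_upwards [hae] with z hz
    have : w z ^ D * ‖MvPolynomial.eval z p‖ = 0 := by
      rw [hD, pow_add, mul_right_comm, hz, zero_mul]
    simp [this]
  obtain ⟨C, -, hC⟩ := hBM 1 one_pos
  have h3 := hC D p (Nat.le_add_left _ _)
  rw [h2, mul_zero] at h3
  refine hw.eq_zero_of_eval_eq_zero hE fun z hz hwz => ?_
  have h4 := (hw.le_supNorm hE D p hz).trans h3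
  have h5 : 0 < w z ^ D := pow_pos hwz D
  exact norm_le_zero_iff.1 (nonpos_of_mul_nonpos_right h4 h5)

end Integrability

/-! ### Gram–Schmidt along the graded lexicographic order -/

section GramSchmidt

/-- Initial segments of the graded lexicographic order in finitely many variables are finite. -/
instance degLexLocallyFiniteOrderBot : LocallyFiniteOrderBot (DegLex (Fin N →₀ ℕ)) :=
  have hfin : ∀ a : DegLex (Fin N →₀ ℕ), (Set.Iic a).Finite := fun a =>
    (Finsupp.finite_of_degree_le (σ := Fin N) (ofDegLex a).degree).subset fun _ hb =>
      Finsupp.DegLex.monotone_degree hb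
  LocallyFiniteOrderBot.ofIic _ (fun a => (hfin a).toFinset) (by simp)

/-- The polynomials all of whose monomials precede `z^α`. -/
def lowerSubmodule (α : Fin N →₀ ℕ) : Submodule ℂ (MvPolynomial (Fin N) ℂ) where
  carrier := {q | ∀ β, q.coeff β ≠ 0 → Precedes β α}
  zero_mem' := fun β h => absurd (MvPolynomial.coeff_zero β) h
  add_mem' := by
    intro p q hp hq β h
    by_cases h1 : p.coeff β = 0
    · exact hq β fun h2 => h (by rw [MvPolynomial.coeff_add, h1, h2, add_zero])
    · exact hp β h1
  smul_mem' := by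
    intro c p hp β h
    rw [MvPolynomial.coeff_smul, smul_eq_mul] at h
    exact hp β (right_ne_zero_of_mul h)

/-- The Gram–Schmidt procedure applied to the monomials, for any inner product on polynomials. -/
lemma exists_orthonormal_of_core (c : InnerProductSpace.Core ℂ (MvPolynomial (Fin N) ℂ)) :
    ∃ p : (Fin N →₀ ℕ) → MvPolynomial (Fin N) ℂ,
      (∀ α β, c.inner (p α) (p β) = if α = β then 1 else 0) ∧
      (∀ α β, β ≠ α → (p α).coeff β ≠ 0 → Precedes β α) ∧
      (∀ α, ((p α).coeff α).im = 0) ∧ ∀ α, 0 < ((p α).coeff α).re := by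
  classical
  let := c.toNormedAddCommGroup
  let : InnerProductSpace ℂ (MvPolynomial (Fin N) ℂ) := InnerProductSpace.ofCore c.toCore
  let f : DegLex (Fin N →₀ ℕ) → MvPolynomial (Fin N) ℂ := fun a =>
    MvPolynomial.monomial (ofDegLex a) 1
  have hf : LinearIndependent ℂ f := by
    have := (MvPolynomial.basisMonomials (Fin N) ℂ).linearIndependent
    rwa [MvPolynomial.coe_basisMonomials] at this
  have hcoeff : ∀ α, InnerProductSpace.gramSchmidt ℂ f (toDegLex α) - MvPolynomial.monomial α 1 ∈
      lowerSubmodule α := by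
    intro α
    have h1 : Submodule.span ℂ (f '' Set.Iio (toDegLex α)) ≤ lowerSubmodule α := by
      rw [Submodule.span_le]
      rintro _ ⟨b, hb, rfl⟩ β hβ
      simp only [f, MvPolynomial.coeff_monomial] at hβ
      have : ofDegLex b = β := by by_contra h; simp [h] at hβ
      rw [← this]
      exact hb
    apply h1
    rw [← InnerProductSpace.span_gramSchmidt_Iio ℂ f (toDegLex α)]
    have h2 := InnerProductSpace.gramSchmidt_def'' ℂ f (toDegLex α)
    have h3 : InnerProductSpace.gramSchmidt ℂ f (toDegLex α) - MvPolynomial.monomial α 1 =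
        InnerProductSpace.gramSchmidt ℂ f (toDegLex α) - f (toDegLex α) := rfl
    rw [h3]
    rw [h2]
    rw [sub_add_cancel_left]
    refine Submodule.neg_mem _ (Submodule.sum_mem _ fun i hi => Submodule.smul_mem _ _ ?_)
    exact Submodule.subset_span ⟨i, Finset.mem_Iio.1 hi, rfl⟩
  have hg1 : ∀ α, (InnerProductSpace.gramSchmidt ℂ f (toDegLex α)).coeff α = 1 := by
    intro α
    by_contra h
    have h2 := hcoeff α α
    rw [MvPolynomial.coeff_sub, MvPolynomial.coeff_monomial, if_pos rfl, sub_ne_zero] at h2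
    exact lt_irrefl _ (h2 h)
  have hg2 : ∀ α β, β ≠ α → (InnerProductSpace.gramSchmidt ℂ f (toDegLex α)).coeff β ≠ 0 →
      Precedes β α := by
    intro α β hβ h
    have h2 := hcoeff α β
    rw [MvPolynomial.coeff_sub, MvPolynomial.coeff_monomial, if_neg hβ.symm, sub_zero] at h2
    exact h2 h
  have hpos : ∀ α, 0 < ‖InnerProductSpace.gramSchmidt ℂ f (toDegLex α)‖⁻¹ := fun α =>
    inv_pos.2 (norm_pos_iff.2 (InnerProductSpace.gramSchmidt_ne_zero _ hf))
  have hlead : ∀ α, (InnerProductSpace.gramSchmidtNormed ℂ f (toDegLex α)).coeff α =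
      ((‖InnerProductSpace.gramSchmidt ℂ f (toDegLex α)‖⁻¹ : ℝ) : ℂ) := by
    intro α
    rw [InnerProductSpace.gramSchmidtNormed, MvPolynomial.coeff_smul, hg1]
    simp
  refine ⟨fun α => InnerProductSpace.gramSchmidtNormed ℂ f (toDegLex α), ?_, ?_, ?_, ?_⟩
  · intro α β
    have := (orthonormal_iff_ite.1 (InnerProductSpace.gramSchmidtNormed_orthonormal (𝕜 := ℂ) hf))
      (toDegLex α) (toDegLex β)
    exact this.trans (if_congr Iff.rfl rfl rfl)
  · intro α β hβ h
    dsimp only at h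
    rw [InnerProductSpace.gramSchmidtNormed, MvPolynomial.coeff_smul, smul_eq_mul] at h
    exact hg2 α β hβ (right_ne_zero_of_mul h)
  · intro α
    rw [hlead, Complex.ofReal_im]
  · intro α
    rw [hlead, Complex.ofReal_re]
    exact hpos α

end GramSchmidt

/-! ### Orthonormal families and their leading coefficients -/

section Orthonormal

variable {E : Set (Fin N → ℂ)} {w : (Fin N → ℂ) → ℝ} {μ : Measure (Fin N → ℂ)} [IsFiniteMeasure μ]

theorem exists_isOrthonormalFamily (hE : IsCompact E) (hw : IsAdmissibleWeight E w)
    (hμ : μ.support = E) (hBM : WeightedBernsteinMarkov E w μ) (d : ℕ) :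
    ∃ p, IsOrthonormalFamily w μ d p := by
  let c : InnerProductSpace.Core ℂ (MvPolynomial (Fin N) ℂ) :=
    { inner := fun p q => weightedInner w μ d q p
      conj_inner_symm := fun p q => conj_weightedInner d p q
      re_inner_nonneg := fun p => by
        change 0 ≤ (weightedInner w μ d p p).re
        rw [weightedInner_self, Complex.ofReal_re]
        exact sq_nonneg _
      add_left := fun p q r => by
        rw [← conj_weightedInner, weightedInner_add_left hE hw hμ, map_add, conj_weightedInner,
          conj_weightedInner]
      smul_left := fun p q a => by
        rw [← conj_weightedInner, weightedInner_smul_left, map_mul, conj_weightedInner]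
      definite := fun p hp => by
        rw [weightedInner_self, Complex.ofReal_eq_zero, sq_eq_zero_iff] at hp
        exact eq_zero_of_l2Norm_eq_zero hE hw hμ hBM hp }
  obtain ⟨p, h1, h2, h3, h4⟩ := exists_orthonormal_of_core c
  exact ⟨p, fun α β => (h1 β α).trans (by simp only [eq_comm]), h2, h3, h4⟩

variable {d : ℕ} {p : (Fin N →₀ ℕ) → MvPolynomial (Fin N) ℂ}

omit [IsFiniteMeasure μ] in
lemma IsOrthonormalFamily.coeff_eq (hp : IsOrthonormalFamily w μ d p) (α : Fin N →₀ ℕ) :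
    (p α).coeff α = (((p α).coeff α).re : ℂ) :=
  Complex.ext rfl (by simpa using hp.lead_real α)

/-- `p^d_α` is orthogonal to every monomial `z^β` preceding `z^α`, by induction on `β`. -/
lemma IsOrthonormalFamily.weightedInner_monomial (hE : IsCompact E) (hw : IsAdmissibleWeight E w)
    (hμ : μ.support = E) (hp : IsOrthonormalFamily w μ d p) {α β : Fin N →₀ ℕ}
    (h : Precedes β α) : weightedInner w μ d (MvPolynomial.monomial β 1) (p α) = 0 := by
  classical
  induction hb : toDegLex β using WellFoundedLT.induction generalizing β with
  | ind b ih =>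
    subst hb
    have hne : β ≠ α := fun h' => lt_irrefl _ (h' ▸ h : Precedes α α)
    set a := (p β).coeff β with ha
    have ha0 : a ≠ 0 := fun h' => by
      have := hp.lead_pos β
      rw [← ha, h'] at this
      simp at this
    have h1 : weightedInner w μ d (p β - a • MvPolynomial.monomial β 1) (p α) = 0 := by
      refine weightedInner_eq_zero_of_coeff hE hw hμ d fun γ hγ => ?_
      rw [MvPolynomial.coeff_sub, MvPolynomial.coeff_smul, MvPolynomial.coeff_monomial] at hγ
      by_cases hγβ : γ = β
      · subst hγβ; simp [ha] at hγ
      · rw [if_neg (Ne.symm hγβ), smul_zero, sub_zero] at hγ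
        have h2 := hp.lower β γ hγβ hγ
        exact ih _ h2 (lt_trans h2 h) rfl
    have h2 : weightedInner w μ d (p β) (p α) = 0 := (hp.orthonormal β α).trans (if_neg hne)
    have h3 : p β = (p β - a • MvPolynomial.monomial β 1) + a • MvPolynomial.monomial β 1 := by ring
    rw [h3, weightedInner_add_left hE hw hμ, h1, zero_add, weightedInner_smul_left] at h2
    exact (mul_eq_zero.1 h2).resolve_left ha0

lemma IsOrthonormalFamily.weightedInner_lower (hE : IsCompact E) (hw : IsAdmissibleWeight E w)
    (hμ : μ.support = E) (hp : IsOrthonormalFamily w μ d p) {α : Fin N →₀ ℕ}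
    {g : MvPolynomial (Fin N) ℂ} (hg : g ∈ lowerSubmodule α) :
    weightedInner w μ d g (p α) = 0 :=
  weightedInner_eq_zero_of_coeff hE hw hμ d fun β hβ =>
    hp.weightedInner_monomial hE hw hμ (hg β hβ)

omit [IsFiniteMeasure μ] in
lemma IsOrthonormalFamily.inv_smul_mem_monicClass (hp : IsOrthonormalFamily w μ d p)
    (α : Fin N →₀ ℕ) : ((((p α).coeff α).re : ℂ))⁻¹ • p α ∈ monicClass α := by
  refine ⟨?_, fun β hβ h => ?_⟩
  · rw [MvPolynomial.coeff_smul, ← hp.coeff_eq, smul_eq_mul, inv_mul_cancel₀]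
    rw [hp.coeff_eq]
    exact_mod_cast (hp.lead_pos α).ne'
  · rw [MvPolynomial.coeff_smul, smul_eq_mul] at h
    exact hp.lower α β hβ (right_ne_zero_of_mul h)

lemma sub_mem_lowerSubmodule {α : Fin N →₀ ℕ} {q r : MvPolynomial (Fin N) ℂ}
    (hq : q ∈ monicClass α) (hr : r ∈ monicClass α) : q - r ∈ lowerSubmodule α := by
  intro β h
  rw [MvPolynomial.coeff_sub] at h
  by_cases hβ : β = α
  · subst hβ; simp [hq.1, hr.1] at h
  · by_cases h1 : q.coeff β = 0
    · exact hr.2 β hβ fun h2 => h (by rw [h1, h2, sub_zero])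
    · exact hq.2 β hβ h1

omit [IsFiniteMeasure μ] in
lemma IsOrthonormalFamily.l2Norm_eq_one (hp : IsOrthonormalFamily w μ d p) (α : Fin N →₀ ℕ) :
    l2Norm w μ d (p α) = 1 := by
  have h1 : weightedInner w μ d (p α) (p α) = 1 := (hp.orthonormal α α).trans (if_pos rfl)
  rw [weightedInner_self] at h1
  have h2 : l2Norm w μ d (p α) ^ 2 = 1 := by exact_mod_cast h1
  exact (pow_eq_one_iff_of_nonneg (l2Norm_nonneg d _) two_ne_zero).1 h2

theorem isOrthonormalFamily_unique (hE : IsCompact E) (hw : IsAdmissibleWeight E w)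
    (hμ : μ.support = E) (hBM : WeightedBernsteinMarkov E w μ)
    {p' : (Fin N →₀ ℕ) → MvPolynomial (Fin N) ℂ} (hp : IsOrthonormalFamily w μ d p)
    (hp' : IsOrthonormalFamily w μ d p') : p = p' := by
  ext1 α
  set a := ((p α).coeff α).re with ha
  set a' := ((p' α).coeff α).re with ha'
  have ha0 : 0 < a := hp.lead_pos α
  have ha0' : 0 < a' := hp'.lead_pos α
  set g := (a : ℂ)⁻¹ • p α - (a' : ℂ)⁻¹ • p' α with hg
  have hgl : g ∈ lowerSubmodule α :=
    sub_mem_lowerSubmodule (hp.inv_smul_mem_monicClass α) (hp'.inv_smul_mem_monicClass α)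
  have h1 := hp.weightedInner_lower hE hw hμ hgl
  have h2 := hp'.weightedInner_lower hE hw hμ hgl
  rw [← conj_weightedInner, map_eq_zero] at h1 h2
  have h3 : weightedInner w μ d g g = 0 := by
    nth_rw 1 [hg]
    rw [sub_eq_add_neg, ← neg_smul, weightedInner_add_left hE hw hμ, weightedInner_smul_left,
      weightedInner_smul_left, h1, h2, mul_zero, mul_zero, add_zero]
  rw [weightedInner_self, Complex.ofReal_eq_zero, sq_eq_zero_iff] at h3
  have h4 := eq_zero_of_l2Norm_eq_zero hE hw hμ hBM h3
  rw [hg, sub_eq_zero] at h4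
  have h5 := congrArg (l2Norm w μ d) h4
  rw [l2Norm_smul, l2Norm_smul, hp.l2Norm_eq_one, hp'.l2Norm_eq_one, mul_one, mul_one, norm_inv,
    norm_inv, Complex.norm_real, Complex.norm_real, Real.norm_of_nonneg ha0.le,
    Real.norm_of_nonneg ha0'.le, inv_inj] at h5
  rw [h5] at h4
  exact smul_right_injective _ (inv_ne_zero (by exact_mod_cast ha0'.ne' : (a' : ℂ) ≠ 0)) h4

/-- The polynomial `p^d_α / a` has the smallest `L²` norm in `P(α)`: the difference from any other
element is orthogonal to it. -/
lemma IsOrthonormalFamily.inv_lead_le_l2Norm (hE : IsCompact E) (hw : IsAdmissibleWeight E w)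
    (hμ : μ.support = E) (hp : IsOrthonormalFamily w μ d p) {α : Fin N →₀ ℕ}
    {q : MvPolynomial (Fin N) ℂ} (hq : q ∈ monicClass α) :
    (((p α).coeff α).re)⁻¹ ≤ l2Norm w μ d q := by
  set a := ((p α).coeff α).re with ha
  have ha0 : 0 < a := hp.lead_pos α
  set r := (a : ℂ)⁻¹ • p α with hr
  set g := q - r with hg
  have hgl : g ∈ lowerSubmodule α := sub_mem_lowerSubmodule hq (hp.inv_smul_mem_monicClass α)
  have h1 := hp.weightedInner_lower hE hw hμ hgl
  have h1' := h1
  rw [← conj_weightedInner, map_eq_zero] at h1'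
  have hrg : weightedInner w μ d r g = 0 := by rw [hr, weightedInner_smul_left, h1', mul_zero]
  have hgr : weightedInner w μ d g r = 0 := by rw [← conj_weightedInner, hrg, map_zero]
  have hpyth : weightedInner w μ d q q = weightedInner w μ d g g + weightedInner w μ d r r := by
    have hq' : q = g + r := by rw [hg]; ring
    have hl : ∀ s, weightedInner w μ d q s = weightedInner w μ d g s + weightedInner w μ d r s :=
      fun s => by rw [hq', weightedInner_add_left hE hw hμ]
    have e1 : weightedInner w μ d g q = weightedInner w μ d g g := by
      rw [← conj_weightedInner, hl, map_add, conj_weightedInner, conj_weightedInner, hgr, add_zero]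
    have e2 : weightedInner w μ d r q = weightedInner w μ d r r := by
      rw [← conj_weightedInner, hl, map_add, conj_weightedInner, conj_weightedInner, hrg, zero_add]
    rw [hl, e1, e2]
  rw [weightedInner_self, weightedInner_self, weightedInner_self] at hpyth
  have h2 : l2Norm w μ d q ^ 2 = l2Norm w μ d g ^ 2 + l2Norm w μ d r ^ 2 := by exact_mod_cast hpyth
  have h3 : l2Norm w μ d r = a⁻¹ := by
    rw [hr, l2Norm_smul, hp.l2Norm_eq_one, mul_one, norm_inv, Complex.norm_real,
      Real.norm_of_nonneg ha0.le]
  rw [← h3]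
  exact le_of_sq_le_sq (by rw [h2]; linarith [sq_nonneg (l2Norm w μ d g)]) (l2Norm_nonneg d q)

lemma totalDegree_le_of_mem_monicClass {α : Fin N →₀ ℕ} {q : MvPolynomial (Fin N) ℂ}
    (hq : q ∈ monicClass α) : q.totalDegree ≤ α.degree := by
  refine Finset.sup_le fun β hβ => ?_
  have := degree_le_of_mem_monicClass hq hβ
  rwa [Finsupp.degree_apply] at this

lemma IsOrthonormalFamily.inv_lead_le_chebyshevNorm (hE : IsCompact E) (hw : IsAdmissibleWeight E w)
    (hμ : μ.support = E) {α : Fin N →₀ ℕ} (hp : IsOrthonormalFamily w μ α.degree p) :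
    (((p α).coeff α).re)⁻¹ ≤ Real.sqrt (μ.real Set.univ) * chebyshevNorm E w α := by
  have hM : 0 < Real.sqrt (μ.real Set.univ) := by
    apply Real.sqrt_pos.2
    refine lt_of_le_of_ne measureReal_nonneg fun h => ?_
    rw [eq_comm, measureReal_eq_zero_iff, Measure.measure_univ_eq_zero] at h
    subst h
    rw [Measure.support_zero] at hμ
    exact hw.nonempty.ne_empty hμ.symm
  rw [← div_le_iff₀' hM]
  refine le_chebyshevNorm fun q hq => ?_
  rw [div_le_iff₀' hM]
  exact (hp.inv_lead_le_l2Norm hE hw hμ hq).trans (l2Norm_le_supNorm hE hw hμ _ q)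

omit [IsFiniteMeasure μ] in
lemma IsOrthonormalFamily.chebyshevNorm_le_inv_lead (hw : IsAdmissibleWeight E w) {C ε : ℝ}
    (hC : ∀ (d : ℕ) (p : MvPolynomial (Fin N) ℂ), p.totalDegree ≤ d →
      supNorm E w d p ≤ C * (1 + ε) ^ d * l2Norm w μ d p)
    {α : Fin N →₀ ℕ} (hp : IsOrthonormalFamily w μ α.degree p) :
    chebyshevNorm E w α ≤ C * (1 + ε) ^ α.degree * (((p α).coeff α).re)⁻¹ := by
  have hm := hp.inv_smul_mem_monicClass α
  have h1 := (chebyshevNorm_le hw hm).trans (hC _ _ (totalDegree_le_of_mem_monicClass hm))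
  rwa [l2Norm_smul, hp.l2Norm_eq_one, mul_one, norm_inv, Complex.norm_real,
    Real.norm_of_nonneg (hp.lead_pos α).le] at h1

theorem tendsto_log_lead (hE : IsCompact E) (hw : IsAdmissibleWeight E w)
    (hμ : μ.support = E) (hBM : WeightedBernsteinMarkov E w μ)
    {p : ℕ → (Fin N →₀ ℕ) → MvPolynomial (Fin N) ℂ} (hp : ∀ d, IsOrthonormalFamily w μ d (p d))
    (hY : ∀ α, 0 < chebyshevNorm E w α) {α : ℕ → (Fin N →₀ ℕ)}
    (hα : Tendsto (fun j => (α j).degree) atTop atTop) {L : ℝ}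
    (hL : Tendsto (fun j => Real.log (chebyshevNorm E w (α j)) / ((α j).degree : ℝ)) atTop (𝓝 L)) :
    Tendsto (fun j => Real.log (((p (α j).degree (α j)).coeff (α j)).re) / ((α j).degree : ℝ)) atTop
      (𝓝 (-L)) := by
  set a : ℕ → ℝ := fun j => ((p (α j).degree (α j)).coeff (α j)).re with ha
  have ha0 : ∀ j, 0 < a j := fun j => (hp _).lead_pos _
  set Y : ℕ → ℝ := fun j => chebyshevNorm E w (α j) with hYd
  have hd : Tendsto (fun j => ((α j).degree : ℝ)) atTop atTop :=
    tendsto_natCast_atTop_atTop.comp hα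
  suffices h : Tendsto (fun j => (Real.log (a j) + Real.log (Y j)) / ((α j).degree : ℝ)) atTop
      (𝓝 0) by
    have := h.sub hL
    rw [zero_sub] at this
    refine this.congr fun j => ?_
    ring
  set M := Real.sqrt (μ.real Set.univ) with hM
  have hlow : ∀ j, -Real.log M ≤ Real.log (a j) + Real.log (Y j) := by
    intro j
    have h1 : (a j)⁻¹ ≤ M * Y j := (hp _).inv_lead_le_chebyshevNorm hE hw hμ
    have hM0 : 0 < M := by
      by_contra h
      have := mul_nonpos_of_nonpos_of_nonneg (not_lt.1 h) (hY (α j)).le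
      exact absurd (h1.trans this) (not_le.2 (inv_pos.2 (ha0 j)))
    have h2 := Real.log_le_log (inv_pos.2 (ha0 j)) h1
    rw [Real.log_inv, Real.log_mul hM0.ne' (hY _).ne'] at h2
    linarith
  have hup : ∀ ε > 0, ∃ K : ℝ, ∀ j,
      Real.log (a j) + Real.log (Y j) ≤ K + (α j).degree * Real.log (1 + ε) := by
    intro ε hε
    obtain ⟨C, hC0, hC⟩ := hBM ε hε
    refine ⟨Real.log C, fun j => ?_⟩
    have h1 : Y j ≤ C * (1 + ε) ^ (α j).degree * (a j)⁻¹ :=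
      (hp _).chebyshevNorm_le_inv_lead hw hC
    have h2 := Real.log_le_log (hY _) h1
    rw [Real.log_mul (by positivity) (inv_pos.2 (ha0 j)).ne', Real.log_mul hC0.ne' (by positivity),
      Real.log_pow, Real.log_inv] at h2
    linarith
  rw [Metric.tendsto_atTop']
  intro ε hε
  -- With `1 + ε' = exp (ε / 2)` the factor `(1 + ε') ^ d` contributes exactly `ε / 2`.
  obtain ⟨K, hK⟩ := hup (Real.exp (ε / 2) - 1)
    (by linarith [Real.add_one_lt_exp (half_pos hε).ne'])
  rw [add_sub_cancel, Real.log_exp] at hK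
  have hl : ∀ᶠ j in atTop, max |Real.log M| |K| < ε / 2 * (α j).degree :=
    (hd.const_mul_atTop (half_pos hε)).eventually_gt_atTop _
  obtain ⟨J, hJ⟩ := eventually_atTop.1 (hl.and (hd.eventually_gt_atTop 0))
  refine ⟨J, fun j hj => ?_⟩
  obtain ⟨h1, h2⟩ := hJ j hj.le
  rw [Real.dist_eq, sub_zero, abs_lt, lt_div_iff₀ h2, div_lt_iff₀ h2]
  have h3 := hK j
  have h4 := hlow j
  have h5 := (le_abs_self (Real.log M)).trans (le_max_left _ |K|)
  have h6 := (le_abs_self K).trans (le_max_right |Real.log M| _)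
  constructor <;> nlinarith

end Orthonormal

lemma rpow_one_div_eq_exp {x : ℝ} (hx : 0 < x) (n : ℕ) :
    x ^ (1 / (n : ℝ)) = Real.exp (Real.log x / n) := by
  rw [Real.rpow_def_of_pos hx, mul_one_div]

end WeightedPoly

end

theorem theorem4p1 {N : ℕ} (E : Set (Fin N → ℂ)) (hE : IsCompact E)
    (w : (Fin N → ℂ) → ℝ) (hw : WeightedPoly.IsAdmissibleWeight E w)
    (μ : MeasureTheory.Measure (Fin N → ℂ)) [MeasureTheory.IsFiniteMeasure μ]
    (hμ : μ.support = E)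
    (hBM : WeightedPoly.WeightedBernsteinMarkov E w μ)
    (θ : Fin N → ℝ) (hθ_pos : ∀ i, 0 < θ i) (hθ_sum : ∑ i, θ i = 1) :
    (∀ d : ℕ, ∃! p : (Fin N →₀ ℕ) → MvPolynomial (Fin N) ℂ,
      WeightedPoly.IsOrthonormalFamily w μ d p) ∧
    ∃ τ : ℝ, 0 < τ ∧ WeightedPoly.IsDirectionalChebyshevConstant E w θ τ ∧
      ∀ p : ℕ → (Fin N →₀ ℕ) → MvPolynomial (Fin N) ℂ,
        (∀ d, WeightedPoly.IsOrthonormalFamily w μ d (p d)) →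
        ∀ α : ℕ → (Fin N →₀ ℕ), WeightedPoly.HasDirection α θ →
          Filter.Tendsto
            (fun j => (((p (α j).degree (α j)).coeff (α j)).re) ^ (1 / ((α j).degree : ℝ)))
            Filter.atTop (nhds (1 / τ)) := by
  obtain ⟨hY, L, hL⟩ := WeightedPoly.exists_tendsto_log_chebyshevNorm hE hw hθ_pos
  refine ⟨fun d => ?_, Real.exp L, Real.exp_pos L, fun α hα => ?_, fun p hp α hα => ?_⟩
  · obtain ⟨p, hp⟩ := WeightedPoly.exists_isOrthonormalFamily hE hw hμ hBM d
    exact ⟨p, hp, fun p' hp' => WeightedPoly.isOrthonormalFamily_unique hE hw hμ hBM hp' hp⟩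
  · have h1 := (Real.continuous_exp.tendsto L).comp (hL.comp hα.tendsto)
    refine h1.congr fun j => ?_
    rw [WeightedPoly.rpow_one_div_eq_exp (hY _)]
    rfl
  · have h1 := WeightedPoly.tendsto_log_lead hE hw hμ hBM hp hY hα.1 (hL.comp hα.tendsto)
    rw [one_div, ← Real.exp_neg]
    refine ((Real.continuous_exp.tendsto _).comp h1).congr fun j => ?_
    rw [WeightedPoly.rpow_one_div_eq_exp ((hp _).lead_pos _)]
    rfl
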